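/- Let $H$ and $\mathcal H$ be Hilbert spaces (both real or both complex) with inner products $(\cdot,\cdot)$, $\langle\cdot,\cdot\rangle$ and norms $\|\cdot\|$, $|\cdot|$, and let $H$ be compactly embedded in $\mathcal H$, with $|u|\le c_0\|u\|$ for $u\in H$. Let $H_1,H_2$ be infinite-dimensional closed subspaces of $H$, let $S_j$ be the orthogonal projector of $H$ onto $H_j$, and let $\sigma=\sigma(H_1,H_2)$ be the best constant in $$|(S_1-S_2)u|^2\le\sigma\|u\|^2,\qquad u\in H.$$ Define $K_j:H_j\to H_j$ by $(K_ju,v)=\langle u,v\rangle$ for $u,v\in H_j$; this is a compact, self-adjoint, positive operator. Let $0<\lambda_1<\lambda_2<\cdots$ be the numbers whose inverses are the distinct eigenvalues of $K_1$. Fix $m\ge1$ and put $X_m=\{\varphi\in H_1: K_1\varphi=\lambda_m^{-1}\varphi\}$, $J_m=\dim X_m$. For $\varphi\in X_m$ put $S\varphi=S_2\varphi$ and $T\varphi=\varphi-S_2\varphi$, let $\Psi_\varphi\in H_2$ be the solution of $$(\Psi_\varphi,w)=(\varphi,w)-\lambda_m\langle\varphi,w\rangle\qquad\text{for all }w\in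 H_2,$$ and let $$\rho=\max_{\varphi\in X_m,\ \|\varphi\|=1}\bigl(|T\varphi|^2+|\Psi_\varphi|^2+\sigma\|\Psi_\varphi\|^2\bigr).$$ **Theorem.** There are positive constants $\sigma_0,c,C$, depending only on $m$, $\lambda_1,\dots,\lambda_{m+1}$ and $c_0$, such that the following holds whenever $\sigma\le\sigma_0$. The closed interval $[\lambda_m^{-1}-c\sqrt\sigma,\ \lambda_m^{-1}+c\sqrt\sigma]$ is contained in the open interval $(\lambda_{m+1}^{-1}+c\sqrt\sigma,\ \lambda_{m-1}^{-1}-c\sqrt\sigma)$ (with right endpoint $+\infty$ if $m=1$). Counted with multiplicity, $K_2$ has exactly $J_m$ eigenvalues $\mu_1^{-1},\dots,\mu_{J_m}^{-1}$ in the open interval, and all of them lie in the closed one. The eigenvalue problem of finding $\varphi\in X_m$, $\varphi\neq0$, with $$\frac1{\lambda_m}\Bigl((\Psi_\varphi,\Psi_\psi)-(T\varphi,T\psi)-(\Psi_\varphi,\psi)-(\varphi,\Psi_\psi)\Bigr)=\tau\,(S\varphi,S\psi)\qquad\text{for all }\psi\in X_m$$ has exactly $J_m$ eigenvalues $\tau$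 counted with multiplicity, all of them real. With a suitable numbering $\tau_1,\dots,\tau_{J_m}$ of these eigenvalues and $\mu_1^{-1},\dots,\mu_{J_m}^{-1}$ of those of $K_2$, $$\bigl|\mu_k^{-1}-\lambda_m^{-1}-\tau_k\bigr|\le C\bigl(\rho+|\tau_k|\,\sigma\bigr),\qquad k=1,\dots,J_m.$$ -/

import Mathlib

open scoped InnerProductSpace

namespace SpectralPerturbation

/-!
Convention: Mathlib's inner product `⟪x, y⟫_𝕜` is conjugate linear in `x` and linear in `y`, so the
form written `(u, v)` (linear in `u`) is `⟪v, u⟫_𝕜` here.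

`H` and `G` are Hilbert spaces and `ι : H →L[𝕜] G` is the embedding of `H` into `G`; thus `⟨u, v⟩`
is `⟪ι v, ι u⟫_𝕜`, and `‖ι u‖` is the weaker norm `|u|`.
-/

section

variable {𝕜 H G : Type*} [RCLike 𝕜]
  [NormedAddCommGroup H] [InnerProductSpace 𝕜 H]
  [NormedAddCommGroup G] [InnerProductSpace 𝕜 G] [CompleteSpace G]

/-- The operator `K : N → N` on a closed subspace `N` of `H`, `(K u, v) = ⟨u, v⟩` for `u, v ∈ N`
(see `inner_gramOp`). -/
noncomputable def gramOp (ι : H →L[𝕜] G) (N : Submodule 𝕜 H) [CompleteSpace N] : N →L[𝕜] N :=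
  (ContinuousLinearMap.adjoint (ι ∘L N.subtypeL)) ∘L (ι ∘L N.subtypeL)

theorem inner_gramOp (ι : H →L[𝕜] G) (N : Submodule 𝕜 H) [CompleteSpace N] (u v : N) :
    ⟪v, gramOp ι N u⟫_𝕜 = ⟪ι (v : H), ι (u : H)⟫_𝕜 := by
  simp [gramOp, ContinuousLinearMap.adjoint_inner_right]

/-- `l 0 < l 1 < ... < l (n - 1)` are the first `n` values `ν > 0` (each listed once) such that
`ν⁻¹` is an eigenvalue of `K`. -/
def IsFirstEigenvalues {N : Type*} [NormedAddCommGroup N] [InnerProductSpace 𝕜 N]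
    (K : N →L[𝕜] N) {n : ℕ} (l : Fin n → ℝ) : Prop :=
  StrictMono l ∧
  (∀ j, 0 < l j ∧ Module.End.HasEigenvalue (K : N →ₗ[𝕜] N) (((l j)⁻¹ : ℝ) : 𝕜)) ∧
  ∀ ν : ℝ, 0 < ν → Module.End.HasEigenvalue (K : N →ₗ[𝕜] N) ((ν⁻¹ : ℝ) : 𝕜) →
    (∃ j, l j = ν) ∨ ∀ j, l j < ν

/-- Multiplicity of the real number `κ` as an eigenvalue of `K` (zero if it is none). -/
noncomputable def eigenMult {N : Type*} [NormedAddCommGroup N] [InnerProductSpace 𝕜 N]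
    (K : N →L[𝕜] N) (κ : ℝ) : ℕ :=
  Module.finrank 𝕜 (Module.End.eigenspace (K : N →ₗ[𝕜] N) (κ : 𝕜))

/-- The eigenspace `X = {φ ∈ H₁ : K₁ φ = lam⁻¹ φ}`, as a subspace of `H`. -/
noncomputable def eigX (ι : H →L[𝕜] G) (H₁ : Submodule 𝕜 H) [CompleteSpace H₁] (lam : ℝ) :
    Submodule 𝕜 H :=
  (Module.End.eigenspace (gramOp ι H₁ : H₁ →ₗ[𝕜] H₁) ((lam⁻¹ : ℝ) : 𝕜)).map H₁.subtype

/-- The proximity `σ(H₁, H₂)`: the best constant in `|(S₁ - S₂) u|² ≤ σ ‖u‖²`, `u ∈ H`, where `Sⱼ`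
is the orthogonal projector of `H` onto `Hⱼ`. -/
noncomputable def proximity (ι : H →L[𝕜] G) (H₁ H₂ : Submodule 𝕜 H)
    [CompleteSpace H₁] [CompleteSpace H₂] : ℝ :=
  sInf {s : ℝ | 0 ≤ s ∧
    ∀ u : H, ‖ι (H₁.starProjection u - H₂.starProjection u)‖ ^ 2 ≤ s * ‖u‖ ^ 2}

theorem isLeast_proximity (ι : H →L[𝕜] G) (H₁ H₂ : Submodule 𝕜 H)
    [CompleteSpace H₁] [CompleteSpace H₂] :
    IsLeast {s : ℝ | 0 ≤ s ∧
      ∀ u : H, ‖ι (H₁.starProjection u - H₂.starProjection u)‖ ^ 2 ≤ s * ‖u‖ ^ 2}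
      (proximity ι H₁ H₂) := by
  have hne : {s : ℝ | 0 ≤ s ∧
      ∀ u : H, ‖ι (H₁.starProjection u - H₂.starProjection u)‖ ^ 2 ≤ s * ‖u‖ ^ 2}.Nonempty := by
    refine ⟨‖ι ∘L (H₁.starProjection - H₂.starProjection)‖ ^ 2, by positivity, fun u => ?_⟩
    rw [← mul_pow]
    exact pow_le_pow_left₀ (norm_nonneg _)
      ((ι ∘L (H₁.starProjection - H₂.starProjection)).le_opNorm u) 2
  have hcl : IsClosed {s : ℝ | 0 ≤ s ∧
      ∀ u : H, ‖ι (H₁.starProjection u - H₂.starProjection u)‖ ^ 2 ≤ s * ‖u‖ ^ 2} := by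
    simp only [Set.setOf_and, Set.setOf_forall]
    exact isClosed_Ici.inter (isClosed_iInter fun u =>
      isClosed_le continuous_const (continuous_id.mul continuous_const))
  have hb : BddBelow {s : ℝ | 0 ≤ s ∧
      ∀ u : H, ‖ι (H₁.starProjection u - H₂.starProjection u)‖ ^ 2 ≤ s * ‖u‖ ^ 2} :=
    ⟨0, fun s hs => hs.1⟩
  exact ⟨hcl.csInf_mem hne hb, fun s hs => csInf_le hb hs⟩

/-- `T φ = φ - S₂ φ`. -/
noncomputable def opT (H₂ : Submodule 𝕜 H) [CompleteSpace H₂] : H →L[𝕜] H :=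
  ContinuousLinearMap.id 𝕜 H - H₂.starProjection

/-- `Ψ_φ ∈ H₂`, the solution of `(Ψ, w) = (φ, w) - lam ⟨φ, w⟩` for all `w ∈ H₂`
(see `inner_psi` and `eq_psi`). -/
noncomputable def psi (ι : H →L[𝕜] G) (H₂ : Submodule 𝕜 H) [CompleteSpace H₂] (lam : ℝ) :
    H →L[𝕜] H₂ :=
  H₂.orthogonalProjectionOnto -
    ((lam : ℝ) : 𝕜) • ((ContinuousLinearMap.adjoint (ι ∘L H₂.subtypeL)) ∘L ι)

theorem inner_psi (ι : H →L[𝕜] G) (H₂ : Submodule 𝕜 H) [CompleteSpace H₂] (lam : ℝ)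
    (φ : H) (w : H₂) :
    ⟪w, psi ι H₂ lam φ⟫_𝕜 = ⟪(w : H), φ⟫_𝕜 - (lam : 𝕜) * ⟪ι (w : H), ι φ⟫_𝕜 := by
  simp [psi, inner_sub_right, inner_smul_right, ContinuousLinearMap.adjoint_inner_right]

theorem eq_psi (ι : H →L[𝕜] G) (H₂ : Submodule 𝕜 H) [CompleteSpace H₂] (lam : ℝ)
    (φ : H) (p : H₂)
    (hp : ∀ w : H₂, ⟪w, p⟫_𝕜 = ⟪(w : H), φ⟫_𝕜 - (lam : 𝕜) * ⟪ι (w : H), ι φ⟫_𝕜) :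
    p = psi ι H₂ lam φ :=
  ext_inner_left 𝕜 fun w => by rw [hp, inner_psi]

/-- `ρ = max {|T φ|² + |Ψ_φ|² + σ ‖Ψ_φ‖² : φ ∈ X, ‖φ‖ = 1}`. -/
noncomputable def rho (ι : H →L[𝕜] G) (H₁ H₂ : Submodule 𝕜 H)
    [CompleteSpace H₁] [CompleteSpace H₂] (lam : ℝ) : ℝ :=
  sSup ((fun φ : H => ‖ι (opT H₂ φ)‖ ^ 2 + ‖ι (psi ι H₂ lam φ : H)‖ ^ 2 +
      proximity ι H₁ H₂ * ‖psi ι H₂ lam φ‖ ^ 2) '' {φ | φ ∈ eigX ι H₁ lam ∧ ‖φ‖ = 1})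

/-- The form
`lam⁻¹ ((Ψ_φ, Ψ_ψ) - (T φ, T ψ) - (Ψ_φ, ψ) - (φ, Ψ_ψ))`. -/
noncomputable def formA (ι : H →L[𝕜] G) (H₂ : Submodule 𝕜 H) [CompleteSpace H₂] (lam : ℝ)
    (φ ψ : H) : 𝕜 :=
  ((lam⁻¹ : ℝ) : 𝕜) *
    (⟪psi ι H₂ lam ψ, psi ι H₂ lam φ⟫_𝕜 - ⟪opT H₂ ψ, opT H₂ φ⟫_𝕜
      - ⟪ψ, (psi ι H₂ lam φ : H)⟫_𝕜 - ⟪(psi ι H₂ lam ψ : H), φ⟫_𝕜)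

/-- The space of all `φ ∈ X` with
`lam⁻¹ ((Ψ_φ, Ψ_ψ) - (T φ, T ψ) - (Ψ_φ, ψ) - (φ, Ψ_ψ)) = τ (S₂ φ, S₂ ψ)` for all `ψ ∈ X`. -/
noncomputable def pencilEigenspace (ι : H →L[𝕜] G) (H₁ H₂ : Submodule 𝕜 H)
    [CompleteSpace H₁] [CompleteSpace H₂] (lam : ℝ) (τ : 𝕜) : Submodule 𝕜 H where
  carrier := {φ | φ ∈ eigX ι H₁ lam ∧ ∀ ψ ∈ eigX ι H₁ lam,
    formA ι H₂ lam φ ψ = τ * ⟪H₂.starProjection ψ, H₂.starProjection φ⟫_𝕜}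
  zero_mem' := ⟨zero_mem _, fun ψ _ => by simp [formA]⟩
  add_mem' := by
    rintro a b ⟨ha, ha'⟩ ⟨hb, hb'⟩
    refine ⟨add_mem ha hb, fun ψ hψ => ?_⟩
    have h1 := ha' ψ hψ
    have h2 := hb' ψ hψ
    simp only [formA, map_add, inner_add_right, Submodule.coe_add] at h1 h2 ⊢
    linear_combination h1 + h2
  smul_mem' := by
    rintro c a ⟨ha, ha'⟩
    refine ⟨Submodule.smul_mem _ c ha, fun ψ hψ => ?_⟩
    have h1 := ha' ψ hψ
    simp only [formA, map_smul, inner_smul_right, Submodule.coe_smul] at h1 ⊢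
    linear_combination c * h1

end

end SpectralPerturbation

/-! Write κ = λ_m⁻¹. Extending K_j by zero to B_j = `extGram ι H_j` adds only the eigenvalue 0 and
puts both operators on H. As B_j = S_j ι* ι S_j, the norm of B₁ - B₂ is at most η = 2c₀√σ
(`norm_extGram_sub_le`), so every eigenvalue of B₂ in the window is within η of κ. Let W be spanned
by the corresponding eigenvectors. No nonzero vector of W is orthogonal to X = X_m, since B₁ - κ
would act on it with norm at most 2η and at least the spectral gap; hence dim W ≤ J_m.

S₂ is injective on X with bounded inverse, and the projection of S₂X to W shrinks squared norms by a
factor of at least 1 - O(σ). This gives dim W = J_m. The problem on X is the eigenproblem of a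
symmetric operator on S₂X with the norm of H, and min-max (`abs_eigenvalues_sub_le`) compares it
with B₂ - κ on W: the defect of isometry costs O(|τ|σ), and the discrepancy of the quadratic forms
must be O(ρ).

That last bound is the heart (`abs_re_formA_sub_le`). With x = S₂φ the form on X is ((B₂ - κ)x, x) +
κ‖Ψ‖² - |Tφ|², and weak norms do not bound κ‖Ψ‖². Splitting x = y + q with y ∈ W, the contribution
of q cancels this term except for the part of Ψ in W (`re_formA_sub_eq`). What remains is quadratic
in |Tφ| and |Ψ|, because B₂ turns weak bounds into strong ones (`norm_extGram_le`). -/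

namespace SpectralPerturbation

/-! ### Min-max comparison of ordered eigenvalues in finite dimension -/

/-- Fewer conditions than dimensions: a nonzero vector whose coordinates `i > k` in one basis, and
whose image has the coordinates `i < k` in another one, all vanish. -/
theorem exists_ne_zero_repr_eq_zero {𝕜 E F : Type*} [RCLike 𝕜]
    [NormedAddCommGroup E] [InnerProductSpace 𝕜 E] [NormedAddCommGroup F] [InnerProductSpace 𝕜 F]
    {n : ℕ} (b : OrthonormalBasis (Fin n) 𝕜 E) (b' : OrthonormalBasis (Fin n) 𝕜 F) (e : E →ₗ[𝕜] F)
    (k : Fin n) :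
    ∃ x : E, x ≠ 0 ∧ (∀ i, k < i → b.repr x i = 0) ∧ ∀ i, i < k → b'.repr (e x) i = 0 := by
  have : FiniteDimensional 𝕜 E := b.toBasis.finiteDimensional_of_finite
  let f : E →ₗ[𝕜] ({i : Fin n // i ≠ k} → 𝕜) :=
    LinearMap.pi fun i =>
      if k < i.1 then (EuclideanSpace.proj i.1).toLinearMap ∘ₗ b.repr.toLinearEquiv.toLinearMap
      else (EuclideanSpace.proj i.1).toLinearMap ∘ₗ b'.repr.toLinearEquiv.toLinearMap ∘ₗ e
  have hlt : Module.finrank 𝕜 ({i : Fin n // i ≠ k} → 𝕜) < Module.finrank 𝕜 E := by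
    rw [Module.finrank_eq_card_basis b.toBasis, Module.finrank_fintype_fun_eq_card]
    simpa using Fintype.card_subtype_lt (p := fun i : Fin n => i ≠ k) (x := k) (by simp)
  obtain ⟨x, hx, hx0⟩ := (Submodule.ne_bot_iff _).1 (LinearMap.ker_ne_bot_of_finrank_lt (f := f) hlt)
  refine ⟨x, hx0, fun i hi => ?_, fun i hi => ?_⟩
  · have := congrFun (LinearMap.mem_ker.1 hx) ⟨i, hi.ne'⟩
    simp only [f, LinearMap.pi_apply, if_pos hi] at this
    exact this
  · have := congrFun (LinearMap.mem_ker.1 hx) ⟨i, hi.ne⟩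
    simp only [f, LinearMap.pi_apply, if_neg hi.not_gt] at this
    exact this

section FiniteDimensional

variable {𝕜 E F : Type*} [RCLike 𝕜]
  [NormedAddCommGroup E] [InnerProductSpace 𝕜 E] [FiniteDimensional 𝕜 E]
  [NormedAddCommGroup F] [InnerProductSpace 𝕜 F] [FiniteDimensional 𝕜 F] {n : ℕ}

theorem re_inner_eq_sum_eigenvalues {T : E →ₗ[𝕜] E} (hT : T.IsSymmetric)
    (hn : Module.finrank 𝕜 E = n) (x : E) :
    RCLike.re ⟪x, T x⟫_𝕜 =
      ∑ i, hT.eigenvalues hn i * ‖(hT.eigenvectorBasis hn).repr x i‖ ^ 2 := by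
  rw [← (hT.eigenvectorBasis hn).repr.inner_map_map x (T x), PiLp.inner_apply, map_sum]
  refine Finset.sum_congr rfl fun i _ => ?_
  rw [hT.eigenvectorBasis_apply_self_apply hn, RCLike.inner_apply, mul_assoc, RCLike.mul_conj,
    ← RCLike.ofReal_pow, ← RCLike.ofReal_mul, RCLike.ofReal_re]

theorem mul_norm_sq_le_re_inner {T : E →ₗ[𝕜] E} (hT : T.IsSymmetric)
    (hn : Module.finrank 𝕜 E = n) {x : E} {c : ℝ}
    (h : ∀ i, (hT.eigenvectorBasis hn).repr x i = 0 ∨ c ≤ hT.eigenvalues hn i) :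
    c * ‖x‖ ^ 2 ≤ RCLike.re ⟪x, T x⟫_𝕜 := by
  rw [re_inner_eq_sum_eigenvalues hT hn, ← (hT.eigenvectorBasis hn).repr.norm_map x, EuclideanSpace.norm_sq_eq,
    Finset.mul_sum]
  refine Finset.sum_le_sum fun i _ => ?_
  rcases h i with h | h
  · simp [h]
  · gcongr

theorem re_inner_le_mul_norm_sq {T : E →ₗ[𝕜] E} (hT : T.IsSymmetric)
    (hn : Module.finrank 𝕜 E = n) {x : E} {c : ℝ}
    (h : ∀ i, (hT.eigenvectorBasis hn).repr x i = 0 ∨ hT.eigenvalues hn i ≤ c) :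
    RCLike.re ⟪x, T x⟫_𝕜 ≤ c * ‖x‖ ^ 2 := by
  rw [re_inner_eq_sum_eigenvalues hT hn, ← (hT.eigenvectorBasis hn).repr.norm_map x, EuclideanSpace.norm_sq_eq,
    Finset.mul_sum]
  refine Finset.sum_le_sum fun i _ => ?_
  rcases h i with h | h
  · simp [h]
  · gcongr

/-- Relative perturbation of the ordered eigenvalues of a symmetric operator under a nearly
isometric change of variables. -/
theorem abs_eigenvalues_sub_le {T : E →ₗ[𝕜] E} {T' : F →ₗ[𝕜] F} (hT : T.IsSymmetric)
    (hT' : T'.IsSymmetric) (hn : Module.finrank 𝕜 E = n) (hn' : Module.finrank 𝕜 F = n)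
    (e : E →ₗ[𝕜] F) {ε r : ℝ} (hε : ε ≤ 1 / 2) (hr : 0 ≤ r)
    (he : ∀ x, ‖e x‖ ^ 2 ≤ ‖x‖ ^ 2 ∧ (1 - ε) * ‖x‖ ^ 2 ≤ ‖e x‖ ^ 2)
    (h : ∀ x, |RCLike.re ⟪x, T x⟫_𝕜 - RCLike.re ⟪e x, T' (e x)⟫_𝕜| ≤ r * ‖x‖ ^ 2) (k : Fin n) :
    |hT'.eigenvalues hn' k - hT.eigenvalues hn k| ≤ 2 * (r + |hT.eigenvalues hn k| * ε) := by
  -- Comparison of Rayleigh quotients at a single vector; dividing by ‖e x‖² ≥ ‖x‖²/2 costs the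
  -- factor 2.
  have key : ∀ x : E, x ≠ 0 → ∀ t t' : ℝ,
      (t * ‖x‖ ^ 2 ≤ RCLike.re ⟪x, T x⟫_𝕜 ∧ RCLike.re ⟪e x, T' (e x)⟫_𝕜 ≤ t' * ‖e x‖ ^ 2 →
        t - t' ≤ 2 * (r + |t| * ε)) ∧
      (RCLike.re ⟪x, T x⟫_𝕜 ≤ t * ‖x‖ ^ 2 ∧ t' * ‖e x‖ ^ 2 ≤ RCLike.re ⟪e x, T' (e x)⟫_𝕜 →
        t' - t ≤ 2 * (r + |t| * ε)) := by
    intro x hx t t'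
    have hp : 0 < ‖x‖ ^ 2 := by positivity
    obtain ⟨h1, h2⟩ := he x
    obtain ⟨h3, h4⟩ := abs_le.1 (h x)
    generalize ‖x‖ ^ 2 = p at *
    generalize ‖e x‖ ^ 2 = q at *
    have hq : p ≤ 2 * q := by nlinarith
    have hq0 : 0 < q := by linarith
    have hε0 : 0 ≤ ε * p := by nlinarith
    have h5 : |t * (q - p)| ≤ |t| * (ε * p) := by
      rw [abs_mul]
      refine mul_le_mul_of_nonneg_left ?_ (abs_nonneg t)
      rw [abs_le]; constructor <;> nlinarith
    have h6 : |t| * (ε * p) ≤ |t| * ε * (2 * q) := by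
      have := mul_nonneg (abs_nonneg t) (nonneg_of_mul_nonneg_left hε0 hp)
      rw [← mul_assoc]
      exact mul_le_mul_of_nonneg_left hq this
    have h7 := abs_le.1 h5
    have h8 : r * p ≤ r * (2 * q) := mul_le_mul_of_nonneg_left hq hr
    constructor
    · rintro ⟨ha, hb⟩
      refine le_of_mul_le_mul_right ?_ hq0
      nlinarith
    · rintro ⟨ha, hb⟩
      refine le_of_mul_le_mul_right ?_ hq0
      nlinarith
  have hanti := hT.eigenvalues_antitone hn
  have hanti' := hT'.eigenvalues_antitone hn'
  rw [abs_le]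
  constructor
  -- Eigenvalues are listed in decreasing order: `x` lies in the span of the top k + 1 eigenvectors
  -- of `T`, and `e x` is orthogonal to the top k of `T'`.
  · obtain ⟨x, hx, h1, h2⟩ := exists_ne_zero_repr_eq_zero (hT.eigenvectorBasis hn)
      (hT'.eigenvectorBasis hn') e k
    have := (key x hx (hT.eigenvalues hn k) (hT'.eigenvalues hn' k)).1
      ⟨mul_norm_sq_le_re_inner hT hn fun i => (lt_or_ge k i).imp (h1 i) fun hi => hanti hi,
        re_inner_le_mul_norm_sq hT' hn' fun i => (lt_or_ge i k).imp (h2 i) fun hi => hanti' hi⟩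
    linarith
  -- Both bases are reversed, so the same dimension count now works from the bottom of the spectrum.
  · obtain ⟨x, hx, h1, h2⟩ := exists_ne_zero_repr_eq_zero
      ((hT.eigenvectorBasis hn).reindex Fin.revPerm)
      ((hT'.eigenvectorBasis hn').reindex Fin.revPerm) e k.rev
    have h1' : ∀ i, i < k → (hT.eigenvectorBasis hn).repr x i = 0 := fun i hi => by
      simpa using h1 i.rev (Fin.rev_lt_rev.2 hi)
    have h2' : ∀ i, k < i → (hT'.eigenvectorBasis hn').repr (e x) i = 0 := fun i hi => by
      simpa using h2 i.rev (Fin.rev_lt_rev.2 hi)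
    have := (key x hx (hT.eigenvalues hn k) (hT'.eigenvalues hn' k)).2
      ⟨re_inner_le_mul_norm_sq hT hn fun i => (lt_or_ge i k).imp (h1' i) fun hi => hanti hi,
        mul_norm_sq_le_re_inner hT' hn' fun i => (lt_or_ge k i).imp (h2' i) fun hi => hanti' hi⟩
    linarith

end FiniteDimensional

/-! ### Spectral subspaces of symmetric operators -/

section SpectralSpan

variable {𝕜 E : Type*} [RCLike 𝕜] [NormedAddCommGroup E] [InnerProductSpace 𝕜 E]

open Module.End

/-- The span of the eigenvectors of `B` with eigenvalues in `s`. -/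
noncomputable def spectralSpan (B : E →L[𝕜] E) (s : Set 𝕜) : Submodule 𝕜 E :=
  ⨆ μ : s, eigenspace (B : E →ₗ[𝕜] E) (μ : 𝕜)

theorem eigenspace_le_spectralSpan (B : E →L[𝕜] E) {s : Set 𝕜} {μ : 𝕜} (hμ : μ ∈ s) :
    eigenspace (B : E →ₗ[𝕜] E) μ ≤ spectralSpan B s :=
  le_iSup (fun μ : s => eigenspace (B : E →ₗ[𝕜] E) (μ : 𝕜)) ⟨μ, hμ⟩

theorem apply_mem_spectralSpan (B : E →L[𝕜] E) (s : Set 𝕜) {x : E} (hx : x ∈ spectralSpan B s) :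
    B x ∈ spectralSpan B s := by
  have : spectralSpan B s ≤ (spectralSpan B s).comap (B : E →ₗ[𝕜] E) := by
    refine iSup_le fun μ y hy => ?_
    have hy' : B y = (μ : 𝕜) • y := mem_eigenspace_iff.1 hy
    rw [Submodule.mem_comap]
    change B y ∈ _
    rw [hy']
    exact Submodule.smul_mem _ _ (eigenspace_le_spectralSpan B μ.2 hy)
  exact this hx

theorem apply_mem_orthogonal {B : E →L[𝕜] E} (hB : (B : E →ₗ[𝕜] E).IsSymmetric)
    {W : Submodule 𝕜 E} (hW : ∀ x ∈ W, B x ∈ W) {x : E} (hx : x ∈ Wᗮ) : B x ∈ Wᗮ := by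
  intro y hy
  have : ⟪B y, x⟫_𝕜 = ⟪y, B x⟫_𝕜 := hB y x
  rw [← this]
  exact hx _ (hW y hy)

theorem starProjection_apply_comm {B : E →L[𝕜] E} (hB : (B : E →ₗ[𝕜] E).IsSymmetric)
    {W : Submodule 𝕜 E} [W.HasOrthogonalProjection] (hW : ∀ x ∈ W, B x ∈ W) (x : E) :
    W.starProjection (B x) = B (W.starProjection x) := by
  refine Submodule.eq_starProjection_of_mem_orthogonal
    (hW _ (W.starProjection_apply_mem x)) ?_
  rw [← map_sub]
  exact apply_mem_orthogonal hB hW (W.sub_starProjection_mem_orthogonal x)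

/-- A finite sum of eigenvectors, as an orthogonal expansion. -/
theorem exists_expansion {B : E →L[𝕜] E} (hB : (B : E →ₗ[𝕜] E).IsSymmetric) {s : Set 𝕜} {x : E}
    (hx : x ∈ spectralSpan B s) :
    ∃ (t : Finset s) (a : s → ℝ), (∀ μ, 0 ≤ a μ) ∧
      (∀ μ : s, HasEigenvalue (B : E →ₗ[𝕜] E) (μ : 𝕜) ∨ a μ = 0) ∧
      ‖x‖ ^ 2 = ∑ μ ∈ t, a μ ∧
        ∀ κ : 𝕜, ‖B x - κ • x‖ ^ 2 = ∑ μ ∈ t, ‖(μ : 𝕜) - κ‖ ^ 2 * a μ := by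
  classical
  obtain ⟨f, rfl⟩ := (Submodule.mem_iSup_iff_exists_dfinsupp' _ _).1 hx
  have hV : OrthogonalFamily 𝕜 (fun μ : s => eigenspace (B : E →ₗ[𝕜] E) (μ : 𝕜))
      fun μ => (eigenspace (B : E →ₗ[𝕜] E) (μ : 𝕜)).subtypeₗᵢ :=
    hB.orthogonalFamily_eigenspaces.comp Subtype.coe_injective
  refine ⟨f.support, fun μ => ‖f μ‖ ^ 2, fun μ => by positivity, fun μ => ?_, ?_, fun κ => ?_⟩
  · by_cases h : f μ = 0
    · exact Or.inr (by simp [h])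
    · exact Or.inl (hasEigenvalue_of_hasEigenvector ⟨(f μ).2, by simpa using h⟩)
  · exact hV.norm_sum (fun μ => f μ) f.support
  · have h1 : ∀ μ : s, B (f μ : E) - κ • (f μ : E) =
        (((μ : 𝕜) - κ) • f μ : eigenspace (B : E →ₗ[𝕜] E) (μ : 𝕜)) := fun μ => by
      have : B (f μ : E) = (μ : 𝕜) • (f μ : E) := mem_eigenspace_iff.1 (f μ).2
      rw [this, Submodule.coe_smul, sub_smul]
    have h2 := hV.norm_sum (fun μ => ((μ : 𝕜) - κ) • f μ) f.support
    simp only [DFinsupp.sum, map_sum, Finset.smul_sum, ← Finset.sum_sub_distrib, h1]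
    simp only [Submodule.coe_norm, Submodule.coe_smul, norm_smul, mul_pow] at h2 ⊢
    exact h2

theorem norm_sub_smul_le_of_mem_spectralSpan {B : E →L[𝕜] E}
    (hB : (B : E →ₗ[𝕜] E).IsSymmetric) {s : Set 𝕜} {κ : 𝕜} {w : ℝ} (hw : 0 ≤ w)
    (h : ∀ μ ∈ s, HasEigenvalue (B : E →ₗ[𝕜] E) μ → ‖μ - κ‖ ≤ w) {x : E}
    (hx : x ∈ spectralSpan B s) : ‖B x - κ • x‖ ≤ w * ‖x‖ := by
  obtain ⟨t, a, ha, ha', h1, h2⟩ := exists_expansion hB hx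
  refine le_of_sq_le_sq ?_ (by positivity)
  rw [mul_pow, h1, h2, Finset.mul_sum]
  refine Finset.sum_le_sum fun μ _ => ?_
  rcases ha' μ with h' | h'
  · have := h μ μ.2 h'
    have := ha μ
    gcongr
  · simp [h']

theorem le_norm_sub_smul_of_mem_spectralSpan {B : E →L[𝕜] E}
    (hB : (B : E →ₗ[𝕜] E).IsSymmetric) {s : Set 𝕜} {κ : 𝕜} {δ : ℝ} (hδ : 0 ≤ δ)
    (h : ∀ μ ∈ s, HasEigenvalue (B : E →ₗ[𝕜] E) μ → δ ≤ ‖μ - κ‖) {x : E}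
    (hx : x ∈ spectralSpan B s) : δ * ‖x‖ ≤ ‖B x - κ • x‖ := by
  obtain ⟨t, a, ha, ha', h1, h2⟩ := exists_expansion hB hx
  refine le_of_sq_le_sq ?_ (norm_nonneg _)
  rw [mul_pow, h1, h2, Finset.mul_sum]
  refine Finset.sum_le_sum fun μ _ => ?_
  rcases ha' μ with h' | h'
  · have := h μ μ.2 h'
    have := ha μ
    gcongr
  · simp [h']

/-- By the spectral theorem all eigenspaces together, the kernel included, have trivial orthogonal
complement. So a vector of `Wᗮ` equals its projection onto the closure of `W'`: the difference is
orthogonal to both. -/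
theorem orthogonal_spectralSpan_le_closure [CompleteSpace E] {B : E →L[𝕜] E}
    (hB : (B : E →ₗ[𝕜] E).IsSymmetric) (hc : IsCompactOperator B) (s : Set 𝕜) :
    (spectralSpan B s)ᗮ ≤ (spectralSpan B sᶜ).topologicalClosure := by
  set W := spectralSpan B s
  set W' := spectralSpan B sᶜ
  have hall : W ⊔ W' = ⨆ μ, eigenspace (B : E →ₗ[𝕜] E) μ := by
    refine le_antisymm (sup_le (iSup_le fun μ => le_iSup _ _) (iSup_le fun μ => le_iSup _ _))
      (iSup_le fun μ => ?_)
    by_cases h : μ ∈ s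
    · exact (eigenspace_le_spectralSpan B h).trans le_sup_left
    · exact (eigenspace_le_spectralSpan B (s := sᶜ) h).trans le_sup_right
  have hbot : Wᗮ ⊓ W'ᗮ = ⊥ := by
    rw [Submodule.inf_orthogonal, hall]
    exact ContinuousLinearMap.orthogonalComplement_iSup_eigenspaces_eq_bot hc hB
  have hort : W' ≤ Wᗮ := by
    rw [← Submodule.isOrtho_iff_le]
    refine Submodule.isOrtho_iSup_left.2 fun μ => Submodule.isOrtho_iSup_right.2 fun ν => ?_
    exact hB.orthogonalFamily_eigenspaces.isOrtho fun h : (μ : 𝕜) = ν => μ.2 (h ▸ ν.2)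
  have hort' : W'.topologicalClosure ≤ Wᗮ :=
    Submodule.topologicalClosure_minimal _ hort (Submodule.isClosed_orthogonal _)
  intro x hx
  have : CompleteSpace W'.topologicalClosure :=
    W'.isClosed_topologicalClosure.completeSpace_coe
  have h1 := W'.topologicalClosure.sub_starProjection_mem_orthogonal x
  have h2 := W'.topologicalClosure.starProjection_apply_mem x
  have h3 : x - W'.topologicalClosure.starProjection x ∈ Wᗮ ⊓ W'ᗮ :=
    ⟨sub_mem hx (hort' h2), Submodule.orthogonal_le W'.le_topologicalClosure h1⟩
  rw [hbot, Submodule.mem_bot, sub_eq_zero] at h3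
  rwa [h3]

/-- The orthogonal expansion gives the bound on finite sums of eigenvectors, and continuity carries
it to the closure. It stands in for a resolvent estimate. -/
theorem le_norm_sub_smul_of_mem_orthogonal [CompleteSpace E] {B : E →L[𝕜] E}
    (hB : (B : E →ₗ[𝕜] E).IsSymmetric) (hc : IsCompactOperator B) {s : Set 𝕜} {κ : 𝕜} {δ : ℝ}
    (hδ : 0 ≤ δ) (h : ∀ μ ∉ s, HasEigenvalue (B : E →ₗ[𝕜] E) μ → δ ≤ ‖μ - κ‖) {x : E}
    (hx : x ∈ (spectralSpan B s)ᗮ) : δ * ‖x‖ ≤ ‖B x - κ • x‖ := by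
  have hcl : IsClosed {y : E | δ * ‖y‖ ≤ ‖B y - κ • y‖} :=
    isClosed_le (by fun_prop) (by fun_prop)
  exact closure_minimal (fun y hy => le_norm_sub_smul_of_mem_spectralSpan hB hδ h hy) hcl
    (orthogonal_spectralSpan_le_closure hB hc s hx)

end SpectralSpan

/-! ### The operators K_j extended by zero to H -/

section CompressedGram

variable {𝕜 H G : Type*} [RCLike 𝕜]
  [NormedAddCommGroup H] [InnerProductSpace 𝕜 H] [CompleteSpace H]
  [NormedAddCommGroup G] [InnerProductSpace 𝕜 G] [CompleteSpace G]

open Module.End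

/-- The extension by zero of `gramOp ι N` to all of `H`. -/
noncomputable def extGram (ι : H →L[𝕜] G) (N : Submodule 𝕜 H) [CompleteSpace N] : H →L[𝕜] H :=
  (ContinuousLinearMap.adjoint (ι ∘L N.starProjection)) ∘L (ι ∘L N.starProjection)

theorem inner_extGram (ι : H →L[𝕜] G) (N : Submodule 𝕜 H) [CompleteSpace N] (u v : H) :
    ⟪v, extGram ι N u⟫_𝕜 = ⟪ι (N.starProjection v), ι (N.starProjection u)⟫_𝕜 := by
  simp [extGram, ContinuousLinearMap.adjoint_inner_right]

theorem extGram_isSymmetric (ι : H →L[𝕜] G) (N : Submodule 𝕜 H) [CompleteSpace N] :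
    (extGram ι N : H →ₗ[𝕜] H).IsSymmetric := by
  intro u v
  change ⟪extGram ι N u, v⟫_𝕜 = ⟪u, extGram ι N v⟫_𝕜
  rw [inner_extGram, ← inner_conj_symm, inner_extGram, inner_conj_symm]

theorem extGram_isCompactOperator {ι : H →L[𝕜] G} (hι : IsCompactOperator ι) (N : Submodule 𝕜 H)
    [CompleteSpace N] : IsCompactOperator (extGram ι N) :=
  (hι.comp_clm N.starProjection).clm_comp (ContinuousLinearMap.adjoint (ι ∘L N.starProjection))

theorem extGram_starProjection (ι : H →L[𝕜] G) (N : Submodule 𝕜 H) [CompleteSpace N] (u : H) :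
    extGram ι N (N.starProjection u) = extGram ι N u := by
  refine ext_inner_left 𝕜 fun v => ?_
  rw [inner_extGram, inner_extGram,
    Submodule.starProjection_eq_self_iff.2 (N.starProjection_apply_mem u)]

theorem starProjection_extGram (ι : H →L[𝕜] G) (N : Submodule 𝕜 H) [CompleteSpace N] (u : H) :
    N.starProjection (extGram ι N u) = extGram ι N u := by
  refine ext_inner_left 𝕜 fun v => ?_
  rw [← Submodule.inner_starProjection_left_eq_right, inner_extGram, inner_extGram,
    Submodule.starProjection_eq_self_iff.2 (N.starProjection_apply_mem v)]

theorem extGram_mem (ι : H →L[𝕜] G) (N : Submodule 𝕜 H) [CompleteSpace N] (u : H) :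
    extGram ι N u ∈ N :=
  Submodule.starProjection_eq_self_iff.1 (starProjection_extGram ι N u)

theorem extGram_coe (ι : H →L[𝕜] G) (N : Submodule 𝕜 H) [CompleteSpace N] (u : N) :
    extGram ι N (u : H) = (gramOp ι N u : H) := by
  refine ext_inner_left 𝕜 fun v => ?_
  have h := inner_gramOp ι N u (N.orthogonalProjectionOnto v)
  rw [Submodule.coe_inner] at h
  rw [inner_extGram, Submodule.starProjection_eq_self_iff.2 u.2,
    ← Submodule.starProjection_eq_self_iff.2 (gramOp ι N u).2,
    ← Submodule.inner_starProjection_left_eq_right]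
  exact h.symm

/-- The range of the extension lies in N, hence so do its eigenvectors for μ ≠ 0. For μ = 0 the
vectors of Nᗮ would come in. -/
theorem map_eigenspace_gramOp (ι : H →L[𝕜] G) (N : Submodule 𝕜 H) [CompleteSpace N] {μ : 𝕜}
    (hμ : μ ≠ 0) :
    (eigenspace (gramOp ι N : N →ₗ[𝕜] N) μ).map N.subtype =
      eigenspace (extGram ι N : H →ₗ[𝕜] H) μ := by
  ext u
  rw [Submodule.mem_map, mem_eigenspace_iff]
  constructor
  · rintro ⟨v, hv, rfl⟩
    have hv' : gramOp ι N v = μ • v := mem_eigenspace_iff.1 hv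
    change extGram ι N (v : H) = μ • (v : H)
    rw [extGram_coe, hv', Submodule.coe_smul]
  · intro hu
    have hu' : extGram ι N u = μ • u := hu
    have hmem : u ∈ N := by
      have := N.smul_mem μ⁻¹ (extGram_mem ι N u)
      rwa [hu', inv_smul_smul₀ hμ] at this
    refine ⟨⟨u, hmem⟩, mem_eigenspace_iff.2 (Subtype.ext ?_), rfl⟩
    rw [Submodule.coe_smul]
    change ((gramOp ι N ⟨u, hmem⟩ : N) : H) = _
    rw [← extGram_coe]
    exact hu'

theorem hasEigenvalue_gramOp_iff (ι : H →L[𝕜] G) (N : Submodule 𝕜 H) [CompleteSpace N] {μ : 𝕜}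
    (hμ : μ ≠ 0) :
    HasEigenvalue (gramOp ι N : N →ₗ[𝕜] N) μ ↔ HasEigenvalue (extGram ι N : H →ₗ[𝕜] H) μ := by
  rw [hasEigenvalue_iff, hasEigenvalue_iff, ← map_eigenspace_gramOp ι N hμ, Ne, Ne,
    (Submodule.map_injective_of_injective N.subtype_injective).eq_iff' (Submodule.map_bot _)]

theorem eigX_eq_eigenspace (ι : H →L[𝕜] G) (N : Submodule 𝕜 H) [CompleteSpace N] {lam : ℝ}
    (h : lam ≠ 0) :
    eigX ι N lam = eigenspace (extGram ι N : H →ₗ[𝕜] H) ((lam⁻¹ : ℝ) : 𝕜) :=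
  map_eigenspace_gramOp ι N (by simpa using h)

theorem eigenMult_gramOp (ι : H →L[𝕜] G) (N : Submodule 𝕜 H) [CompleteSpace N] {κ : ℝ}
    (h : κ ≠ 0) :
    eigenMult (gramOp ι N) κ =
      Module.finrank 𝕜 (eigenspace (extGram ι N : H →ₗ[𝕜] H) (κ : 𝕜)) := by
  rw [← map_eigenspace_gramOp ι N (by simpa using h), eigenMult]
  exact (LinearEquiv.finrank_eq
    (Submodule.equivMapOfInjective N.subtype N.subtype_injective _))

theorem exists_real_of_hasEigenvalue_extGram (ι : H →L[𝕜] G) (N : Submodule 𝕜 H)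
    [CompleteSpace N] {μ : 𝕜} (h : HasEigenvalue (extGram ι N : H →ₗ[𝕜] H) μ) :
    ∃ r : ℝ, 0 ≤ r ∧ μ = (r : 𝕜) := by
  have h1 := RCLike.conj_eq_iff_re.1 ((extGram_isSymmetric ι N).conj_eigenvalue_eq_self h)
  rw [← h1] at h
  refine ⟨RCLike.re μ, eigenvalue_nonneg_of_nonneg h fun x => ?_, h1.symm⟩
  change 0 ≤ RCLike.re ⟪x, extGram ι N x⟫_𝕜
  rw [inner_extGram]
  exact inner_self_nonneg

/-- Only one of the two factors `ι` is estimated away, so a weak norm bounds a strong one. -/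
theorem norm_extGram_le {ι : H →L[𝕜] G} {c₀ : ℝ} (hc₀ : 0 ≤ c₀) (hι : ∀ u, ‖ι u‖ ≤ c₀ * ‖u‖)
    (N : Submodule 𝕜 H) [CompleteSpace N] (u : H) :
    ‖extGram ι N u‖ ≤ c₀ * ‖ι (N.starProjection u)‖ := by
  have h : ‖ι ∘L N.starProjection‖ ≤ c₀ := by
    refine ContinuousLinearMap.opNorm_le_bound _ hc₀ fun x => (hι _).trans ?_
    exact mul_le_mul_of_nonneg_left (N.norm_starProjection_apply_le x) hc₀
  refine ((ContinuousLinearMap.adjoint (ι ∘L N.starProjection)).le_opNorm _).trans ?_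
  rw [LinearIsometryEquiv.norm_map]
  exact mul_le_mul_of_nonneg_right h (norm_nonneg _)

theorem norm_starProjection_sub_le (ι : H →L[𝕜] G) (H₁ H₂ : Submodule 𝕜 H)
    [CompleteSpace H₁] [CompleteSpace H₂] (u : H) :
    ‖ι (H₁.starProjection u - H₂.starProjection u)‖ ≤ √(proximity ι H₁ H₂) * ‖u‖ := by
  have h := (isLeast_proximity ι H₁ H₂).1
  refine le_of_sq_le_sq ?_ (by positivity)
  rw [mul_pow, Real.sq_sqrt h.1]
  exact h.2 u

/-- Split ⟨S₁y, S₁u⟩ - ⟨S₂y, S₂u⟩ = ⟨S₁y, (S₁ - S₂)u⟩ + ⟨(S₁ - S₂)y, S₂u⟩ and take y = (B₁ - B₂)u.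
-/
theorem norm_extGram_sub_le {ι : H →L[𝕜] G} {c₀ : ℝ} (hc₀ : 0 ≤ c₀)
    (hι : ∀ u, ‖ι u‖ ≤ c₀ * ‖u‖) (H₁ H₂ : Submodule 𝕜 H)
    [CompleteSpace H₁] [CompleteSpace H₂] (u : H) :
    ‖extGram ι H₁ u - extGram ι H₂ u‖ ≤ 2 * c₀ * √(proximity ι H₁ H₂) * ‖u‖ := by
  set s := √(proximity ι H₁ H₂)
  have hs : 0 ≤ s := Real.sqrt_nonneg _
  have hA : ∀ (N : Submodule 𝕜 H) [CompleteSpace N] (x : H),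
      ‖ι (N.starProjection x)‖ ≤ c₀ * ‖x‖ := fun N _ x =>
    (hι _).trans (mul_le_mul_of_nonneg_left (N.norm_starProjection_apply_le x) hc₀)
  set w := extGram ι H₁ u - extGram ι H₂ u
  have h1 : ∀ y : H, ⟪y, w⟫_𝕜 =
      ⟪ι (H₁.starProjection y), ι (H₁.starProjection u - H₂.starProjection u)⟫_𝕜 +
      ⟪ι (H₁.starProjection y - H₂.starProjection y), ι (H₂.starProjection u)⟫_𝕜 := fun y => by
    rw [inner_sub_right, inner_extGram, inner_extGram, map_sub, map_sub, inner_sub_left,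
      inner_sub_right]
    ring
  have h2 : ‖w‖ ^ 2 ≤ 2 * c₀ * s * ‖u‖ * ‖w‖ := by
    have e : ‖w‖ ^ 2 = ‖⟪w, w⟫_𝕜‖ := by
      rw [inner_self_eq_norm_sq_to_K, norm_pow, RCLike.norm_ofReal, abs_norm]
    rw [e, h1 w]
    refine (norm_add_le _ _).trans ?_
    have a := (norm_inner_le_norm (𝕜 := 𝕜) (ι (H₁.starProjection w))
      (ι (H₁.starProjection u - H₂.starProjection u))).trans
      (mul_le_mul (hA H₁ w) (norm_starProjection_sub_le ι H₁ H₂ u) (norm_nonneg _)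
        (by positivity))
    have b := (norm_inner_le_norm (𝕜 := 𝕜) (ι (H₁.starProjection w - H₂.starProjection w))
      (ι (H₂.starProjection u))).trans
      (mul_le_mul (norm_starProjection_sub_le ι H₁ H₂ w) (hA H₂ u) (norm_nonneg _)
        (by positivity))
    nlinarith
  rcases (norm_nonneg w).eq_or_lt with h | h
  · rw [← h]; positivity
  · refine le_of_mul_le_mul_right ?_ h
    rw [← sq]; exact h2

end CompressedGram

/-! ### The form on X against the form of B₂ - κ on W -/

section FormEstimate

variable {𝕜 H G : Type*} [RCLike 𝕜]
  [NormedAddCommGroup H] [InnerProductSpace 𝕜 H] [CompleteSpace H]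
  [NormedAddCommGroup G] [InnerProductSpace 𝕜 G] [CompleteSpace G]

theorem re_inner_extGram_of_mem (ι : H →L[𝕜] G) (N : Submodule 𝕜 H) [CompleteSpace N] {w : H}
    (hw : w ∈ N) (u : H) :
    RCLike.re ⟪w, extGram ι N u⟫_𝕜 = RCLike.re ⟪ι w, ι (N.starProjection u)⟫_𝕜 := by
  rw [inner_extGram, Submodule.starProjection_eq_self_iff.2 hw]

theorem re_inner_psi (ι : H →L[𝕜] G) (N : Submodule 𝕜 H) [CompleteSpace N] {lam : ℝ}
    (hlam : lam ≠ 0) {w : H} (hw : w ∈ N) (φ : H) :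
    lam⁻¹ * RCLike.re ⟪w, (psi ι N lam φ : H)⟫_𝕜 =
      lam⁻¹ * RCLike.re ⟪w, N.starProjection φ⟫_𝕜 - RCLike.re ⟪ι w, ι φ⟫_𝕜 := by
  have h := congrArg RCLike.re (inner_psi ι N lam φ ⟨w, hw⟩)
  rw [Submodule.coe_inner, map_sub, RCLike.re_ofReal_mul] at h
  rw [← Submodule.inner_starProjection_left_eq_right, Submodule.starProjection_eq_self_iff.2 hw, h]
  field_simp

/-- Ψ measures how far φ is from solving the eigenvalue equation tested on N; replacing φ by its
projection adds only a weak term in Tφ. -/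
theorem re_inner_residual (ι : H →L[𝕜] G) (N : Submodule 𝕜 H) [CompleteSpace N] {lam : ℝ}
    (hlam : lam ≠ 0) {w : H} (hw : w ∈ N) (φ : H) :
    RCLike.re ⟪w, extGram ι N (N.starProjection φ)
        - ((lam⁻¹ : ℝ) : 𝕜) • N.starProjection φ⟫_𝕜 =
      -(lam⁻¹ * RCLike.re ⟪w, (psi ι N lam φ : H)⟫_𝕜) - RCLike.re ⟪ι w, ι (opT N φ)⟫_𝕜 := by
  rw [re_inner_psi ι N hlam hw, inner_sub_right, inner_smul_right, map_sub,
    RCLike.re_ofReal_mul, extGram_starProjection, re_inner_extGram_of_mem ι N hw]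
  simp only [opT, sub_apply, ContinuousLinearMap.id_apply, map_sub,
    inner_sub_right]
  ring

/-- Expand in Sφ and Tφ, which are orthogonal in H. The hypothesis `hφ`, expanded in the same way,
removes the term κ‖Tφ‖². -/
theorem re_formA_eq (ι : H →L[𝕜] G) (N : Submodule 𝕜 H) [CompleteSpace N] {lam : ℝ}
    (hlam : lam ≠ 0) {φ : H} (hφ : ‖ι φ‖ ^ 2 = lam⁻¹ * ‖φ‖ ^ 2) :
    RCLike.re (formA ι N lam φ φ) =
      RCLike.re ⟪N.starProjection φ, extGram ι N (N.starProjection φ)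
        - ((lam⁻¹ : ℝ) : 𝕜) • N.starProjection φ⟫_𝕜 +
      lam⁻¹ * ‖(psi ι N lam φ : H)‖ ^ 2 - ‖ι (opT N φ)‖ ^ 2 := by
  have hx := N.starProjection_apply_mem φ
  have hr := re_inner_residual ι N hlam hx φ
  have hp := re_inner_psi ι N hlam hx φ
  have ht : opT N φ = φ - N.starProjection φ := rfl
  have horth : RCLike.re ⟪N.starProjection φ, opT N φ⟫_𝕜 = 0 := by
    rw [ht, Submodule.inner_right_of_mem_orthogonal hx (N.sub_starProjection_mem_orthogonal φ),
      map_zero]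
  have hpt : RCLike.re ⟪φ, (psi ι N lam φ : H)⟫_𝕜 =
      RCLike.re ⟪N.starProjection φ, (psi ι N lam φ : H)⟫_𝕜 := by
    rw [Submodule.inner_starProjection_left_eq_right,
      Submodule.starProjection_eq_self_iff.2 (psi ι N lam φ).2]
  have hnorm : ‖φ‖ ^ 2 = ‖N.starProjection φ‖ ^ 2 + ‖opT N φ‖ ^ 2 := by
    have e : φ = N.starProjection φ + opT N φ := by rw [ht]; abel
    conv_lhs => rw [e]
    rw [norm_add_sq (𝕜 := 𝕜), horth]; ring
  have hι : ι φ = ι (N.starProjection φ) + ι (opT N φ) := by rw [ht, map_sub]; abel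
  have hιn := hφ
  rw [hι, norm_add_sq (𝕜 := 𝕜)] at hιn
  rw [hι, inner_add_right, map_add, inner_self_eq_norm_sq, inner_self_eq_norm_sq] at hp
  rw [hr, formA, RCLike.re_ofReal_mul, map_sub, map_sub, map_sub, inner_self_eq_norm_sq,
    inner_self_eq_norm_sq, inner_re_symm (psi ι N lam φ : H) φ, hpt, Submodule.coe_norm]
  rw [hnorm] at hιn
  linarith

variable {ι : H →L[𝕜] G} {N W : Submodule 𝕜 H} [CompleteSpace N] [W.HasOrthogonalProjection]

/-- The strong norm of Ψ disappears from the right side, except for its part `p₁` in W. The means is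
to evaluate the pairing of `p - p₁` with the residual of `x` twice. -/
theorem re_formA_sub_eq (hWN : W ≤ N) (hW : ∀ u ∈ W, extGram ι N u ∈ W) {lam : ℝ}
    (hlam : lam ≠ 0) {φ : H} (hφ : ‖ι φ‖ ^ 2 = lam⁻¹ * ‖φ‖ ^ 2) {x y q t p p₁ : H}
    (hx : x = N.starProjection φ) (hy : y = W.starProjection x) (hq : q = x - y)
    (ht : t = opT N φ) (hp : p = psi ι N lam φ) (hp₁ : p₁ = W.starProjection p) :
    RCLike.re (formA ι N lam φ φ) - RCLike.re ⟪y, extGram ι N y - ((lam⁻¹ : ℝ) : 𝕜) • y⟫_𝕜 =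
      -‖ι t‖ ^ 2 - RCLike.re ⟪ι q, ι t⟫_𝕜 + lam⁻¹ * ‖p₁‖ ^ 2 - RCLike.re ⟪ι q, ι p⟫_𝕜
        - RCLike.re ⟪ι (p - p₁), ι t⟫_𝕜 := by
  set B := extGram ι N
  set κ : 𝕜 := ((lam⁻¹ : ℝ) : 𝕜)
  have hBs := extGram_isSymmetric ι N
  have hyW : y ∈ W := hy ▸ W.starProjection_apply_mem x
  have hqW : q ∈ Wᗮ := by rw [hq, hy]; exact W.sub_starProjection_mem_orthogonal x
  have hp₁W : p₁ ∈ W := hp₁ ▸ W.starProjection_apply_mem p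
  have hQpW : p - p₁ ∈ Wᗮ := by rw [hp₁]; exact W.sub_starProjection_mem_orthogonal p
  have hxN : x ∈ N := hx ▸ N.starProjection_apply_mem φ
  have hpN : p ∈ N := hp ▸ (psi ι N lam φ).2
  have hqN : q ∈ N := hq ▸ sub_mem hxN (hWN hyW)
  have hQpN : p - p₁ ∈ N := sub_mem hpN (hWN hp₁W)
  have hBy : B y - κ • y ∈ W := sub_mem (hW y hyW) (W.smul_mem _ hyW)
  have hBq : B q - κ • q ∈ Wᗮ :=
    sub_mem (apply_mem_orthogonal hBs hW hqW) (Wᗮ.smul_mem _ hqW)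
  have hsplit : B x - κ • x = (B y - κ • y) + (B q - κ • q) := by
    have : x = y + q := by rw [hq]; abel
    rw [this, map_add, smul_add]; abel
  have h1 := re_formA_eq ι N hlam hφ
  have h2 := re_inner_residual ι N hlam hqN φ
  have h3 := re_inner_residual ι N hlam hQpN φ
  rw [← hx, ← ht, ← hp] at h1 h2 h3
  change _ = RCLike.re ⟪x, B x - κ • x⟫_𝕜 + _ - _ at h1
  change RCLike.re ⟪q, B x - κ • x⟫_𝕜 = _ at h2
  change RCLike.re ⟪p - p₁, B x - κ • x⟫_𝕜 = _ at h3
  have h4 : RCLike.re ⟪x, B x - κ • x⟫_𝕜 =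
      RCLike.re ⟪y, B y - κ • y⟫_𝕜 + RCLike.re ⟪q, B x - κ • x⟫_𝕜 := by
    have h (v : H) : RCLike.re ⟪x, v⟫_𝕜 = RCLike.re ⟪y, v⟫_𝕜 + RCLike.re ⟪q, v⟫_𝕜 := by
      rw [← map_add, ← inner_add_left, hq, add_sub_cancel]
    rw [h]
    nth_rewrite 1 [hsplit]
    rw [ inner_add_right y, Submodule.inner_right_of_mem_orthogonal hyW hBq, add_zero]
  -- The second evaluation: B - κ preserves W and Wᗮ, so `p - p₁` sees only `q`. Against `h3` this
  -- trades κ(q, p) for κ(‖p‖² - ‖p₁‖²) and weak products.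
  have h5 : RCLike.re ⟪p - p₁, B x - κ • x⟫_𝕜 =
      RCLike.re ⟪ι q, ι p⟫_𝕜 - lam⁻¹ * RCLike.re ⟪q, p⟫_𝕜 := by
    rw [hsplit, inner_add_right, Submodule.inner_left_of_mem_orthogonal hBy hQpW, zero_add,
      inner_sub_left, Submodule.inner_right_of_mem_orthogonal hp₁W hBq, sub_zero, inner_sub_right,
      inner_smul_right, map_sub, RCLike.re_ofReal_mul, re_inner_extGram_of_mem ι N hpN,
      Submodule.starProjection_eq_self_iff.2 hqN, inner_re_symm (ι p), inner_re_symm p]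
  have h6 : RCLike.re ⟪p - p₁, p⟫_𝕜 = ‖p‖ ^ 2 - ‖p₁‖ ^ 2 := by
    have : ⟪p₁, p⟫_𝕜 = ⟪p₁, p₁⟫_𝕜 := by
      rw [← sub_eq_zero, ← inner_sub_right, Submodule.inner_right_of_mem_orthogonal hp₁W hQpW]
    rw [inner_sub_left, this, map_sub, inner_self_eq_norm_sq, inner_self_eq_norm_sq]
  rw [h6] at h3
  linarith

/-- The constant in `abs_re_formA_sub_le`. -/
noncomputable def formConst (c₀ κ β δ : ℝ) : ℝ :=
  1 + 2 * ((c₀ * (c₀ * (κ + c₀ ^ 2) / δ) + c₀ ^ 2) / κ + (1 + c₀ * (c₀ / β)))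
    + (1 + c₀ * (c₀ / β)) + κ * (c₀ / β) ^ 2

set_option maxHeartbeats 1000000 in
-- Each factor left by `re_formA_sub_eq`, namely |q|, |p - p₁| and ‖p₁‖, is bounded by a multiple of
-- |Tφ| + |Ψ|.
theorem abs_re_formA_sub_le (hWN : W ≤ N) (hW : ∀ u ∈ W, extGram ι N u ∈ W) {lam c₀ β δ : ℝ}
    (hlam : 0 < lam) (hc₀ : 0 ≤ c₀) (hι : ∀ u, ‖ι u‖ ≤ c₀ * ‖u‖) (hβ : 0 < β) (hδ : 0 < δ)
    (hWβ : ∀ u ∈ W, β * ‖u‖ ≤ ‖extGram ι N u‖)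
    (hWδ : ∀ u ∈ Wᗮ, δ * ‖u‖ ≤ ‖extGram ι N u - ((lam⁻¹ : ℝ) : 𝕜) • u‖)
    {φ : H} (hφ : ‖ι φ‖ ^ 2 = lam⁻¹ * ‖φ‖ ^ 2) {y : H}
    (hy : y = W.starProjection (N.starProjection φ)) :
    |RCLike.re (formA ι N lam φ φ) - RCLike.re ⟪y, extGram ι N y - ((lam⁻¹ : ℝ) : 𝕜) • y⟫_𝕜| ≤
      formConst c₀ lam⁻¹ β δ * (‖ι (opT N φ)‖ + ‖ι (psi ι N lam φ : H)‖) ^ 2 := by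
  obtain ⟨x, hx⟩ : ∃ x, x = N.starProjection φ := ⟨_, rfl⟩
  obtain ⟨q, hq⟩ : ∃ q, q = x - y := ⟨_, rfl⟩
  obtain ⟨t, ht⟩ : ∃ t, t = opT N φ := ⟨_, rfl⟩
  obtain ⟨p, hp⟩ : ∃ p : H, p = psi ι N lam φ := ⟨_, rfl⟩
  obtain ⟨p₁, hp₁⟩ : ∃ p₁, p₁ = W.starProjection p := ⟨_, rfl⟩
  rw [← hx] at hy
  rw [re_formA_sub_eq hWN hW hlam.ne' hφ hx hy hq ht hp hp₁, ← ht, ← hp]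
  set B := extGram ι N
  set κ : 𝕜 := ((lam⁻¹ : ℝ) : 𝕜)
  have hκ : 0 < lam⁻¹ := inv_pos.2 hlam
  have hnκ : ‖κ‖ = lam⁻¹ := RCLike.norm_of_nonneg hκ.le
  have hBs := extGram_isSymmetric ι N
  have hpN : p ∈ N := hp ▸ (psi ι N lam φ).2
  have hxN : x ∈ N := hx ▸ N.starProjection_apply_mem φ
  have hqW : q ∈ Wᗮ := by rw [hq, hy]; exact W.sub_starProjection_mem_orthogonal x
  have hB : ∀ u, ‖B u‖ ≤ c₀ * ‖ι (N.starProjection u)‖ := norm_extGram_le hc₀ hι N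
  have hcontr : ∀ u : H, ‖u - W.starProjection u‖ ≤ ‖u‖ := fun u => by
    rw [← Submodule.starProjection_orthogonal_val]
    exact Wᗮ.norm_starProjection_apply_le u
  obtain ⟨r, hr⟩ : ∃ r, r = B x - κ • x := ⟨_, rfl⟩
  obtain ⟨z, hz⟩ : ∃ z, z = r + κ • p := ⟨_, rfl⟩
  have hrN : r ∈ N := hr ▸ sub_mem (extGram_mem ι N x) (N.smul_mem _ hxN)
  have hzN : z ∈ N := hz ▸ add_mem hrN (N.smul_mem _ hpN)
  set a := ‖ι t‖
  set b := ‖ι p‖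
  have ha : 0 ≤ a := norm_nonneg _
  have hb : 0 ≤ b := norm_nonneg _
  have hz' : ‖z‖ ≤ c₀ * a := by
    have h1 := re_inner_residual ι N hlam.ne' hzN φ
    rw [← hx, ← ht, ← hp] at h1
    change RCLike.re ⟪z, B x - κ • x⟫_𝕜 = _ at h1
    rw [← hr] at h1
    have h2 : ‖z‖ ^ 2 = - RCLike.re ⟪ι z, ι t⟫_𝕜 := by
      rw [← inner_self_eq_norm_sq (𝕜 := 𝕜)]
      nth_rewrite 2 [hz]
      rw [inner_add_right, inner_smul_right, map_add, RCLike.re_ofReal_mul, h1]; ring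
    have h3 : ‖z‖ ^ 2 ≤ c₀ * ‖z‖ * a := by
      rw [h2]
      refine (neg_le_abs _).trans ((RCLike.abs_re_le_norm _).trans
        ((norm_inner_le_norm _ _).trans ?_))
      exact mul_le_mul_of_nonneg_right (hι z) ha
    rcases (norm_nonneg z).eq_or_lt with h | h
    · rw [← h]; positivity
    · refine le_of_mul_le_mul_right ?_ h
      nlinarith
  have hr' : ‖ι r‖ ≤ lam⁻¹ * b + c₀ ^ 2 * a := by
    have : r = z - κ • p := by rw [hz]; abel
    rw [this, map_sub, map_smul]
    refine (norm_sub_le _ _).trans ?_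
    rw [norm_smul, hnκ]
    have := (hι z).trans (mul_le_mul_of_nonneg_left hz' hc₀)
    nlinarith
  have hQr : B q - κ • q = r - W.starProjection r := by
    rw [hr, map_sub, map_smul, starProjection_apply_comm hBs hW, ← hy, hq, map_sub, smul_sub]
    abel
  have hp₁' : ‖p₁‖ ≤ c₀ / β * (a + b) := by
    have h1 := hWβ p₁ (hp₁ ▸ W.starProjection_apply_mem p)
    have h2 : B p₁ = W.starProjection (B p) := by rw [hp₁, starProjection_apply_comm hBs hW]
    have h3 := hB p
    rw [Submodule.starProjection_eq_self_iff.2 hpN] at h3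
    rw [div_mul_eq_mul_div, le_div_iff₀ hβ]
    have h4 : ‖B p₁‖ ≤ ‖B p‖ := h2 ▸ W.norm_starProjection_apply_le _
    have h1' : β * ‖p₁‖ ≤ ‖B p₁‖ := h1
    nlinarith
  have hQp : ‖ι (p - p₁)‖ ≤ (1 + c₀ * (c₀ / β)) * (a + b) := by
    rw [map_sub]
    have h1 := (hι p₁).trans (mul_le_mul_of_nonneg_left hp₁' hc₀)
    have h2 := norm_sub_le (ι p) (ι p₁)
    change _ ≤ b + _ at h2
    linarith
  -- Inverting B - κ on `q` itself would need the strong norm of the residual `r`. On `B q` the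
  -- right side is the part of `B r` in Wᗮ, for which |r| is enough.
  have hBq : ‖B q‖ ≤ c₀ * (lam⁻¹ + c₀ ^ 2) / δ * (a + b) := by
    have h1 : δ * ‖B q‖ ≤ ‖B (B q) - κ • B q‖ := hWδ _ (apply_mem_orthogonal hBs hW hqW)
    have h2 : B (B q) - κ • B q = B r - W.starProjection (B r) := by
      rw [starProjection_apply_comm hBs hW, ← map_sub, ← hQr, map_sub, map_smul]
    rw [h2] at h1
    have h3 := hB r
    rw [Submodule.starProjection_eq_self_iff.2 hrN] at h3
    have h4 := h1.trans ((hcontr _).trans (h3.trans (mul_le_mul_of_nonneg_left hr' hc₀)))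
    rw [div_mul_eq_mul_div, le_div_iff₀ hδ]
    have h5 : 0 ≤ c₀ * (lam⁻¹ * a + c₀ ^ 2 * b) := by positivity
    linarith
  have hq' : ‖ι q‖ ≤ ((c₀ * (c₀ * (lam⁻¹ + c₀ ^ 2) / δ) + c₀ ^ 2) / lam⁻¹ +
      (1 + c₀ * (c₀ / β))) * (a + b) := by
    -- From the identity κq = Bq - (B - κ)q one returns from `B q` to `q`; the only term without a
    -- strong bound, `p - p₁`, is bounded weakly by `hQp`.
    have h1 : κ • q = B q + κ • (p - p₁) - (z - W.starProjection z) := by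
      have : κ • q = B q - (r - W.starProjection r) := by rw [← hQr]; abel
      rw [this, hz, map_add, map_smul, ← hp₁, smul_sub]; abel
    have h2 : lam⁻¹ * ‖ι q‖ ≤ c₀ * ‖B q‖ + lam⁻¹ * ‖ι (p - p₁)‖ + c₀ * (c₀ * a) := by
      rw [← hnκ, ← norm_smul, ← norm_smul, ← map_smul, ← map_smul, h1, map_sub, map_add]
      refine (norm_sub_le _ _).trans (add_le_add ((norm_add_le _ _).trans
        (add_le_add (hι _) le_rfl)) ((hι _).trans ?_))
      exact mul_le_mul_of_nonneg_left ((hcontr z).trans hz') hc₀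
    have h3 := mul_le_mul_of_nonneg_left hBq hc₀
    have h4 := mul_le_mul_of_nonneg_left hQp hκ.le
    have h5 : 0 ≤ c₀ * (c₀ * b) := by positivity
    refine le_of_mul_le_mul_left ?_ hκ
    have h6 : lam⁻¹ * (((c₀ * (c₀ * (lam⁻¹ + c₀ ^ 2) / δ) + c₀ ^ 2) / lam⁻¹ +
        (1 + c₀ * (c₀ / β))) * (a + b)) = (c₀ * (c₀ * (lam⁻¹ + c₀ ^ 2) / δ) + c₀ ^ 2) * (a + b) +
        lam⁻¹ * ((1 + c₀ * (c₀ / β)) * (a + b)) := by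
      field_simp
    rw [h6]
    linarith
  unfold formConst
  generalize (c₀ * (c₀ * (lam⁻¹ + c₀ ^ 2) / δ) + c₀ ^ 2) / lam⁻¹ + (1 + c₀ * (c₀ / β)) = E₄ at *
  generalize 1 + c₀ * (c₀ / β) = E₂ at *
  generalize c₀ / β = E₁ at *
  have cs : ∀ u v : G, |RCLike.re ⟪u, v⟫_𝕜| ≤ ‖u‖ * ‖v‖ := fun u v =>
    (RCLike.abs_re_le_norm _).trans (norm_inner_le_norm _ _)
  have e1 := abs_le.1 ((cs (ι q) (ι t)).trans
    (mul_le_mul hq' (show a ≤ a + b by linarith) ha ((norm_nonneg _).trans hq')))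
  have e2 := abs_le.1 ((cs (ι q) (ι p)).trans
    (mul_le_mul hq' (show b ≤ a + b by linarith) hb ((norm_nonneg _).trans hq')))
  have e3 := abs_le.1 ((cs (ι (p - p₁)) (ι t)).trans
    (mul_le_mul hQp (show a ≤ a + b by linarith) ha ((norm_nonneg _).trans hQp)))
  have e4 : lam⁻¹ * ‖p₁‖ ^ 2 ≤ lam⁻¹ * (E₁ * (a + b)) ^ 2 := by gcongr
  have e5 : 0 ≤ lam⁻¹ * ‖p₁‖ ^ 2 := by positivity
  have e6 : a ^ 2 ≤ (a + b) ^ 2 := by gcongr; linarith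
  have e7 := sq_nonneg a
  rw [abs_le]
  constructor <;> linarith

end FormEstimate

/-! ### Approximate eigenvectors, dimension count, operators representing the form, bounds by ρ -/

section Auxiliary

variable {𝕜 H G : Type*} [RCLike 𝕜]
  [NormedAddCommGroup H] [InnerProductSpace 𝕜 H] [CompleteSpace H]
  [NormedAddCommGroup G] [InnerProductSpace 𝕜 G] [CompleteSpace G]

open Module.End

/-- If no eigenvalue were near κ, the gap estimate with s = ∅, whose orthogonal complement is all of
H, would contradict the smallness of the residual at `u`. -/
theorem exists_hasEigenvalue_near {B : H →L[𝕜] H} (hB : (B : H →ₗ[𝕜] H).IsSymmetric)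
    (hc : IsCompactOperator B) {κ : 𝕜} {η δ : ℝ} {u : H} (hu : u ≠ 0)
    (h : ‖B u - κ • u‖ ≤ η * ‖u‖) (hδ : η < δ) :
    ∃ μ, HasEigenvalue (B : H →ₗ[𝕜] H) μ ∧ ‖μ - κ‖ < δ := by
  by_contra! hcon
  have hu0 : 0 < ‖u‖ := norm_pos_iff.2 hu
  have hη : 0 ≤ η := nonneg_of_mul_nonneg_left ((norm_nonneg _).trans h) hu0
  have hmem : u ∈ (spectralSpan B ∅)ᗮ := by
    have : spectralSpan B ∅ = ⊥ := iSup_of_empty _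
    rw [this, Submodule.bot_orthogonal_eq_top]
    trivial
  have := le_norm_sub_smul_of_mem_orthogonal hB hc (hη.trans hδ.le) (fun μ _ hμ => hcon μ hμ) hmem
  nlinarith

theorem finiteDimensional_and_finrank_le_of_inf_orthogonal {W X : Submodule 𝕜 H}
    [FiniteDimensional 𝕜 X] (h : ∀ u ∈ W, u ∈ Xᗮ → u = 0) :
    FiniteDimensional 𝕜 W ∧ Module.finrank 𝕜 W ≤ Module.finrank 𝕜 X := by
  have hinj : Function.Injective
      ((X.orthogonalProjectionOnto : H →ₗ[𝕜] X) ∘ₗ W.subtype) := by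
    rw [← LinearMap.ker_eq_bot, LinearMap.ker_eq_bot']
    intro u hu
    refine Subtype.ext (h u u.2 ?_)
    exact Submodule.orthogonalProjectionOnto_eq_zero_iff.1 hu
  have := FiniteDimensional.of_injective _ hinj
  exact ⟨this, LinearMap.finrank_le_finrank_of_injective hinj⟩

/-- A Hermitian form `(φ, ψ) ↦ (Z φ, ψ)` on `X`, transported to `S X`. -/
theorem exists_transported_operator {X : Submodule 𝕜 H} [FiniteDimensional 𝕜 X] {S Z : H →L[𝕜] H}
    (hS : ∀ φ ∈ X, S φ = 0 → φ = 0) (hZ : (Z : H →ₗ[𝕜] H).IsSymmetric) :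
    ∃ (M : X.map (S : H →ₗ[𝕜] H) →ₗ[𝕜] H) (T : Module.End 𝕜 (X.map (S : H →ₗ[𝕜] H))),
      T.IsSymmetric ∧ (∀ y, M y ∈ X ∧ S (M y) = y) ∧
      (∀ φ (hφ : φ ∈ X), M ⟨S φ, φ, hφ, rfl⟩ = φ) ∧
      (∀ y y', ⟪y, T y'⟫_𝕜 = ⟪M y, Z (M y')⟫_𝕜) ∧
      Module.finrank 𝕜 (X.map (S : H →ₗ[𝕜] H)) = Module.finrank 𝕜 X := by
  have : CompleteSpace (X.map (S : H →ₗ[𝕜] H)) := FiniteDimensional.complete 𝕜 _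
  have hSinj : ∀ φ ∈ X, ∀ ψ ∈ X, S φ = S ψ → φ = ψ := fun φ hφ ψ hψ h => by
    rw [← sub_eq_zero]
    exact hS _ (sub_mem hφ hψ) (by rw [map_sub, h, sub_self])
  let f : X →ₗ[𝕜] X.map (S : H →ₗ[𝕜] H) :=
    LinearMap.codRestrict _ ((S : H →ₗ[𝕜] H) ∘ₗ X.subtype) fun φ => ⟨φ, φ.2, rfl⟩
  have hf : Function.Bijective f := by
    constructor
    · intro φ ψ h
      exact Subtype.ext (hSinj φ φ.2 ψ ψ.2 (congrArg Subtype.val h))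
    · rintro ⟨_, φ, hφ, rfl⟩
      exact ⟨⟨φ, hφ⟩, rfl⟩
  let g := LinearEquiv.ofBijective f hf
  let M : X.map (S : H →ₗ[𝕜] H) →ₗ[𝕜] H := X.subtype ∘ₗ g.symm.toLinearMap
  let M' : X.map (S : H →ₗ[𝕜] H) →L[𝕜] H := LinearMap.toContinuousLinearMap M
  have hM : ∀ y, M y ∈ X ∧ S (M y) = y := fun y =>
    ⟨(g.symm y).2, congrArg Subtype.val (g.apply_symm_apply y)⟩
  let T : X.map (S : H →ₗ[𝕜] H) →L[𝕜] X.map (S : H →ₗ[𝕜] H) :=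
    ContinuousLinearMap.adjoint M' ∘L Z ∘L M'
  have hT : ∀ y y', ⟪y, T y'⟫_𝕜 = ⟪M y, Z (M y')⟫_𝕜 := fun y y' =>
    ContinuousLinearMap.adjoint_inner_right M' y (Z (M y'))
  refine ⟨M, T, fun y y' => ?_, hM, fun φ hφ => ?_, hT, g.finrank_eq.symm⟩
  · change ⟪T y, y'⟫_𝕜 = ⟪y, T y'⟫_𝕜
    rw [← inner_conj_symm, hT, hT, inner_conj_symm]
    exact hZ _ _
  · exact hSinj _ (hM _).1 _ hφ (hM _).2

theorem exists_isSymmetric_formA (ι : H →L[𝕜] G) (N : Submodule 𝕜 H) [CompleteSpace N]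
    (lam : ℝ) :
    ∃ Z : H →L[𝕜] H, (Z : H →ₗ[𝕜] H).IsSymmetric ∧
      ∀ φ ψ, formA ι N lam φ ψ = ⟪ψ, Z φ⟫_𝕜 := by
  let P := psi ι N lam
  let J : H →L[𝕜] H := N.subtypeL ∘L P
  let Z : H →L[𝕜] H := ((lam⁻¹ : ℝ) : 𝕜) • (ContinuousLinearMap.adjoint P ∘L P -
    ContinuousLinearMap.adjoint (opT N) ∘L opT N - J - ContinuousLinearMap.adjoint J)
  have hZ : ∀ φ ψ, formA ι N lam φ ψ = ⟪ψ, Z φ⟫_𝕜 := fun φ ψ => by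
    simp [formA, Z, J, P, inner_sub_right, inner_smul_right,
      ContinuousLinearMap.adjoint_inner_right]
  refine ⟨Z, fun φ ψ => ?_, hZ⟩
  change ⟪Z φ, ψ⟫_𝕜 = ⟪φ, Z ψ⟫_𝕜
  rw [← inner_conj_symm, ← hZ, ← hZ, formA, formA]
  simp only [map_mul, map_sub, RCLike.conj_ofReal, inner_conj_symm]
  ring

theorem rho_nonneg (ι : H →L[𝕜] G) (H₁ H₂ : Submodule 𝕜 H) [CompleteSpace H₁] [CompleteSpace H₂]
    (lam : ℝ) : 0 ≤ rho ι H₁ H₂ lam := by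
  refine Real.sSup_nonneg ?_
  rintro _ ⟨φ, -, rfl⟩
  have := (isLeast_proximity ι H₁ H₂).1.1
  positivity

/-- Scaling to the unit sphere; the nonnegative term σ‖Ψ‖² of ρ is dropped. -/
theorem norm_sq_add_norm_sq_le_rho (ι : H →L[𝕜] G) (H₁ H₂ : Submodule 𝕜 H)
    [CompleteSpace H₁] [CompleteSpace H₂] (lam : ℝ) {φ : H} (hφ : φ ∈ eigX ι H₁ lam) :
    ‖ι (opT H₂ φ)‖ ^ 2 + ‖ι (psi ι H₂ lam φ : H)‖ ^ 2 ≤ rho ι H₁ H₂ lam * ‖φ‖ ^ 2 := by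
  have hσ := (isLeast_proximity ι H₁ H₂).1.1
  have hb : BddAbove ((fun φ : H => ‖ι (opT H₂ φ)‖ ^ 2 + ‖ι (psi ι H₂ lam φ : H)‖ ^ 2 +
      proximity ι H₁ H₂ * ‖psi ι H₂ lam φ‖ ^ 2) '' {φ | φ ∈ eigX ι H₁ lam ∧ ‖φ‖ = 1}) := by
    refine ⟨‖ι ∘L opT H₂‖ ^ 2 + ‖ι ∘L H₂.subtypeL ∘L psi ι H₂ lam‖ ^ 2 +
      proximity ι H₁ H₂ * ‖psi ι H₂ lam‖ ^ 2, ?_⟩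
    rintro _ ⟨ψ, ⟨-, hψ⟩, rfl⟩
    have h1 := (ι ∘L opT H₂).le_opNorm ψ
    have h2 := (ι ∘L H₂.subtypeL ∘L psi ι H₂ lam).le_opNorm ψ
    have h3 := (psi ι H₂ lam).le_opNorm ψ
    rw [hψ, mul_one] at h1 h2 h3
    change ‖ι (opT H₂ ψ)‖ ≤ _ at h1
    change ‖ι (psi ι H₂ lam ψ : H)‖ ≤ _ at h2
    dsimp only
    gcongr
  rcases eq_or_ne φ 0 with rfl | h0
  · simp
  have hn : 0 < ‖φ‖ := norm_pos_iff.2 h0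
  have hn' : ‖((‖φ‖⁻¹ : ℝ) : 𝕜)‖ = ‖φ‖⁻¹ := RCLike.norm_of_nonneg (by positivity)
  have h := le_csSup hb ⟨((‖φ‖⁻¹ : ℝ) : 𝕜) • φ,
    ⟨Submodule.smul_mem _ _ hφ, by rw [norm_smul, hn', inv_mul_cancel₀ hn.ne']⟩,
    rfl⟩
  change _ ≤ rho ι H₁ H₂ lam at h
  simp only [map_smul, Submodule.coe_smul, norm_smul, hn', mul_pow] at h
  have h' : (‖φ‖⁻¹) ^ 2 * (‖ι (opT H₂ φ)‖ ^ 2 + ‖ι (psi ι H₂ lam φ : H)‖ ^ 2) ≤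
      rho ι H₁ H₂ lam := by
    have : 0 ≤ proximity ι H₁ H₂ * ((‖φ‖⁻¹) ^ 2 * ‖psi ι H₂ lam φ‖ ^ 2) := by positivity
    linarith
  rwa [inv_pow, inv_mul_le_iff₀ (by positivity), mul_comm] at h'

end Auxiliary

/-! ### Eigenvalues of B₂ near an isolated eigenvalue of B₁ -/

section Window

variable {𝕜 H G : Type*} [RCLike 𝕜]
  [NormedAddCommGroup H] [InnerProductSpace 𝕜 H] [CompleteSpace H]
  [NormedAddCommGroup G] [InnerProductSpace 𝕜 G] [CompleteSpace G]

open Module.End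

/-- `κ` is isolated, with gap `d`, from the rest of the spectrum of `extGram ι N`: that part lies
below `κ'` or above the numbers of `U`. -/
structure IsIsolated (ι : H →L[𝕜] G) (N : Submodule 𝕜 H) [CompleteSpace N] (κ κ' d : ℝ)
    (U : Set ℝ) : Prop where
  gap_pos : 0 < d
  pos : 0 < κ'
  gap_le_lower : d ≤ κ - κ'
  gap_le_upper : ∀ x ∈ U, d ≤ x - κ
  subsingleton : U.Subsingleton
  spectrum : ∀ r : ℝ, HasEigenvalue (extGram ι N : H →ₗ[𝕜] H) (r : 𝕜) →
    r = κ ∨ r ≤ κ' ∨ ∃ x ∈ U, x ≤ r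

/-- The window `(κ' + η, x - η)`, `x ∈ U`, about `κ`. -/
def window (κ' η : ℝ) (U : Set ℝ) : Set ℝ := {r | κ' + η < r ∧ ∀ x ∈ U, r < x - η}

theorem norm_ofReal_sub (𝕜 : Type*) [RCLike 𝕜] (r κ : ℝ) : ‖(r : 𝕜) - (κ : 𝕜)‖ = |r - κ| := by
  rw [← RCLike.ofReal_sub, RCLike.norm_ofReal]

variable {ι : H →L[𝕜] G} {H₁ H₂ : Submodule 𝕜 H} [CompleteSpace H₁] [CompleteSpace H₂]
  {κ κ' d η : ℝ} {U : Set ℝ}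

/-- An eigenvector of B₂ is an approximate eigenvector of B₁ with error η, so B₁ has an eigenvalue
nearby; in the window this can only be κ. -/
theorem IsIsolated.abs_sub_le_of_mem_window (h : IsIsolated ι H₁ κ κ' d U)
    (hι : IsCompactOperator ι)
    (hη : ∀ u, ‖extGram ι H₁ u - extGram ι H₂ u‖ ≤ η * ‖u‖) {r : ℝ}
    (hr : HasEigenvalue (extGram ι H₂ : H →ₗ[𝕜] H) (r : 𝕜)) (hrw : r ∈ window κ' η U) :
    |r - κ| ≤ η := by
  by_contra! hlt
  -- `exists_hasEigenvalue_near` needs a radius strictly above η; the window leaves room for one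
  -- that still excludes κ, κ' and U.
  obtain ⟨δ, hδ, h1, h2, h3⟩ : ∃ δ, η < δ ∧ δ ≤ |r - κ| ∧ δ ≤ r - κ' ∧ ∀ x ∈ U, δ ≤ x - r := by
    have ha : η < r - κ' := by linarith [hrw.1]
    rcases h.subsingleton.eq_empty_or_singleton with hU | ⟨x, hU⟩
    · exact ⟨min |r - κ| (r - κ'), lt_min hlt ha, min_le_left _ _, min_le_right _ _, by simp [hU]⟩
    · have hb : η < x - r := by linarith [hrw.2 x (by simp [hU])]
      refine ⟨min (min |r - κ| (r - κ')) (x - r), lt_min (lt_min hlt ha) hb,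
        (min_le_left _ _).trans (min_le_left _ _), (min_le_left _ _).trans (min_le_right _ _), ?_⟩
      simp [hU]
  obtain ⟨u, hu, hu0⟩ := hr.exists_hasEigenvector
  have hu' : extGram ι H₂ u = (r : 𝕜) • u := mem_eigenspace_iff.1 hu
  obtain ⟨μ, hμ, hμr⟩ := exists_hasEigenvalue_near (extGram_isSymmetric ι H₁)
    (extGram_isCompactOperator hι H₁) hu0 (hu' ▸ hη u) hδ
  obtain ⟨s, hs, rfl⟩ := exists_real_of_hasEigenvalue_extGram ι H₁ hμ
  rw [norm_ofReal_sub, abs_lt] at hμr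
  rcases h.spectrum s hμ with rfl | hs' | ⟨x, hx, hs'⟩
  · have : |r - s| < δ := abs_lt.2 ⟨by linarith, by linarith⟩
    linarith
  · linarith
  · linarith [h3 x hx]

/-- The part of `H` that belongs to the eigenvalues of `extGram ι N` in the window. -/
noncomputable def windowSpace (ι : H →L[𝕜] G) (N : Submodule 𝕜 H) [CompleteSpace N]
    (κ' η : ℝ) (U : Set ℝ) : Submodule 𝕜 H :=
  spectralSpan (extGram ι N) ((fun r : ℝ => (r : 𝕜)) '' window κ' η U)

theorem windowSpace_le (hκ' : 0 < κ') (hη : 0 ≤ η) : windowSpace ι H₂ κ' η U ≤ H₂ := by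
  refine iSup_le ?_
  rintro ⟨_, r, hr, rfl⟩ u hu
  have hu' : extGram ι H₂ u = (r : 𝕜) • u := mem_eigenspace_iff.1 hu
  have hr0 : (r : 𝕜) ≠ 0 := by
    have : r ≠ 0 := by linarith [hr.1]
    exact_mod_cast this
  have := H₂.smul_mem (r : 𝕜)⁻¹ (extGram_mem ι H₂ u)
  rwa [hu', inv_smul_smul₀ hr0] at this

theorem IsIsolated.norm_sub_smul_le (h : IsIsolated ι H₁ κ κ' d U) (hι : IsCompactOperator ι)
    (hη0 : 0 ≤ η) (hη : ∀ u, ‖extGram ι H₁ u - extGram ι H₂ u‖ ≤ η * ‖u‖) {u : H}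
    (hu : u ∈ windowSpace ι H₂ κ' η U) : ‖extGram ι H₂ u - (κ : 𝕜) • u‖ ≤ η * ‖u‖ := by
  refine norm_sub_smul_le_of_mem_spectralSpan (extGram_isSymmetric ι H₂) hη0 ?_ hu
  rintro _ ⟨r, hr, rfl⟩ hev
  rw [norm_ofReal_sub]
  exact h.abs_sub_le_of_mem_window hι hη hev hr

/-- Outside the window eigenvalues are at distance at least d - η ≥ d/2 from κ. -/
theorem IsIsolated.le_norm_sub_smul (h : IsIsolated ι H₁ κ κ' d U) (hι : IsCompactOperator ι)
    (hηd : η ≤ d / 2) {u : H}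
    (hu : u ∈ (windowSpace ι H₂ κ' η U)ᗮ) : d / 2 * ‖u‖ ≤ ‖extGram ι H₂ u - (κ : 𝕜) • u‖ := by
  have hd := h.gap_pos
  refine le_norm_sub_smul_of_mem_orthogonal (extGram_isSymmetric ι H₂)
    (extGram_isCompactOperator hι H₂) (by linarith) (fun μ hμs hμ => ?_) hu
  obtain ⟨r, hr0, rfl⟩ := exists_real_of_hasEigenvalue_extGram ι H₂ hμ
  rw [norm_ofReal_sub, le_abs']
  by_contra! hcon
  refine hμs ⟨r, ⟨?_, fun x hx => ?_⟩, rfl⟩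
  · linarith [h.gap_le_lower]
  · linarith [h.gap_le_upper x hx]

/-- B₁ - κ has norm at most 2η on `u`, because `u` is in the window space of B₂, and at least d,
because `u` is orthogonal to X. -/
theorem IsIsolated.eq_zero_of_mem_orthogonal (h : IsIsolated ι H₁ κ κ' d U)
    (hι : IsCompactOperator ι) (hη0 : 0 ≤ η)
    (hη : ∀ u, ‖extGram ι H₁ u - extGram ι H₂ u‖ ≤ η * ‖u‖) (hηd : 2 * η < d) {u : H}
    (hu : u ∈ windowSpace ι H₂ κ' η U)
    (hu' : u ∈ (eigenspace (extGram ι H₁ : H →ₗ[𝕜] H) (κ : 𝕜))ᗮ) : u = 0 := by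
  have hle : spectralSpan (extGram ι H₁) {(κ : 𝕜)} ≤
      eigenspace (extGram ι H₁ : H →ₗ[𝕜] H) (κ : 𝕜) := by
    refine iSup_le ?_
    rintro ⟨_, rfl⟩
    exact le_rfl
  have h1 : d * ‖u‖ ≤ ‖extGram ι H₁ u - (κ : 𝕜) • u‖ := by
    refine le_norm_sub_smul_of_mem_orthogonal (extGram_isSymmetric ι H₁)
      (extGram_isCompactOperator hι H₁) h.gap_pos.le (fun μ hμs hμ => ?_)
      (Submodule.orthogonal_le hle hu')
    obtain ⟨r, hr0, rfl⟩ := exists_real_of_hasEigenvalue_extGram ι H₁ hμ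
    rw [norm_ofReal_sub, le_abs']
    rcases h.spectrum r hμ with rfl | hs | ⟨x, hx, hs⟩
    · exact absurd rfl hμs
    · left; linarith [h.gap_le_lower]
    · right; linarith [h.gap_le_upper x hx]
  have h2 := h.norm_sub_smul_le hι hη0 hη hu
  have h3 : ‖extGram ι H₁ u - (κ : 𝕜) • u‖ ≤ η * ‖u‖ + η * ‖u‖ := by
    rw [← sub_add_sub_cancel _ (extGram ι H₂ u)]
    exact (norm_add_le _ _).trans (add_le_add (hη u) h2)
  by_contra h0
  have := norm_pos_iff.2 h0
  nlinarith

theorem norm_sq_apply_of_mem_eigenspace (hκ : κ ≠ 0) {φ : H}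
    (hφ : φ ∈ eigenspace (extGram ι H₁ : H →ₗ[𝕜] H) (κ : 𝕜)) : ‖ι φ‖ ^ 2 = κ * ‖φ‖ ^ 2 := by
  have hφ' : extGram ι H₁ φ = (κ : 𝕜) • φ := mem_eigenspace_iff.1 hφ
  have hmem : φ ∈ H₁ := by
    have := H₁.smul_mem (κ : 𝕜)⁻¹ (extGram_mem ι H₁ φ)
    rwa [hφ', inv_smul_smul₀ (by exact_mod_cast hκ)] at this
  have h := re_inner_extGram_of_mem ι H₁ hmem φ
  rw [Submodule.starProjection_eq_self_iff.2 hmem, inner_self_eq_norm_sq, hφ', inner_smul_right,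
    RCLike.re_ofReal_mul, inner_self_eq_norm_sq] at h
  exact h.symm

/-- Makes S₂ injective on X with bounded inverse: κφ = B₁φ is close to B₂φ, which depends only on
S₂φ. -/
theorem mul_norm_le_norm_starProjection {c₀ : ℝ} (hc₀ : 0 ≤ c₀) (hι : ∀ u, ‖ι u‖ ≤ c₀ * ‖u‖)
    (hκ : 0 ≤ κ) (hη : ∀ u, ‖extGram ι H₁ u - extGram ι H₂ u‖ ≤ η * ‖u‖) (hηκ : η ≤ κ / 2) {φ : H}
    (hφ : φ ∈ eigenspace (extGram ι H₁ : H →ₗ[𝕜] H) (κ : 𝕜)) :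
    κ / 2 * ‖φ‖ ≤ c₀ ^ 2 * ‖H₂.starProjection φ‖ := by
  have hφ' : extGram ι H₁ φ = (κ : 𝕜) • φ := mem_eigenspace_iff.1 hφ
  have h1 : ‖extGram ι H₂ φ‖ ≤ c₀ ^ 2 * ‖H₂.starProjection φ‖ := by
    refine (norm_extGram_le hc₀ hι H₂ φ).trans ?_
    have := mul_le_mul_of_nonneg_left (hι (H₂.starProjection φ)) hc₀
    nlinarith
  have h2 : κ * ‖φ‖ ≤ η * ‖φ‖ + ‖extGram ι H₂ φ‖ := by
    have : κ * ‖φ‖ = ‖extGram ι H₁ φ‖ := by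
      rw [hφ', norm_smul, RCLike.norm_of_nonneg hκ]
    rw [this]
    have h3 := norm_sub_norm_le (extGram ι H₁ φ) (extGram ι H₂ φ)
    linarith [hη φ]
  have := mul_le_mul_of_nonneg_right hηκ (norm_nonneg φ)
  linarith

/-- S₂φ almost solves the eigenvalue equation of B₂, as (B₂ - κ)S₂φ = S₂(B₂ - B₁)φ. The projection
onto Wᗮ commutes with B₂, and there B₂ - κ is bounded below. -/
theorem IsIsolated.norm_starProjection_sub_le (h : IsIsolated ι H₁ κ κ' d U)
    (hι : IsCompactOperator ι)
    (hη : ∀ u, ‖extGram ι H₁ u - extGram ι H₂ u‖ ≤ η * ‖u‖) (hηd : η ≤ d / 2)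
    [(windowSpace ι H₂ κ' η U).HasOrthogonalProjection] {φ : H}
    (hφ : φ ∈ eigenspace (extGram ι H₁ : H →ₗ[𝕜] H) (κ : 𝕜)) :
    d / 2 * ‖H₂.starProjection φ
      - (windowSpace ι H₂ κ' η U).starProjection (H₂.starProjection φ)‖ ≤ η * ‖φ‖ := by
  have hφ' : extGram ι H₁ φ = (κ : 𝕜) • φ := mem_eigenspace_iff.1 hφ
  set W := windowSpace ι H₂ κ' η U
  set x := H₂.starProjection φ
  have hq := W.sub_starProjection_mem_orthogonal x
  refine (h.le_norm_sub_smul hι hηd hq).trans ?_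
  have e1 : extGram ι H₂ x - (κ : 𝕜) • x =
      H₂.starProjection (extGram ι H₂ φ - extGram ι H₁ φ) := by
    rw [hφ', map_sub, map_smul, starProjection_extGram, extGram_starProjection]
  have e2 : extGram ι H₂ (x - W.starProjection x) - (κ : 𝕜) • (x - W.starProjection x) =
      Wᗮ.starProjection (extGram ι H₂ x - (κ : 𝕜) • x) := by
    rw [Submodule.starProjection_orthogonal_val, map_sub W.starProjection, map_smul,
      starProjection_apply_comm (W := W) (extGram_isSymmetric ι H₂)
        (fun u hu => apply_mem_spectralSpan _ _ hu), map_sub, smul_sub]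
    abel
  rw [e2]
  refine (Wᗮ.norm_starProjection_apply_le _).trans ?_
  rw [e1]
  refine (H₂.norm_starProjection_apply_le _).trans ?_
  rw [norm_sub_rev]
  exact hη φ

end Window

/-! ### The asymptotic formula for one isolated eigenvalue -/

section Splitting

open Module.End

theorem finrank_map_eq_of_injective {𝕜 V V' : Type*} [Field 𝕜] [AddCommGroup V] [Module 𝕜 V]
    [AddCommGroup V'] [Module 𝕜 V'] {f : V →ₗ[𝕜] V'} (hf : Function.Injective f)
    (p : Submodule 𝕜 V) : Module.finrank 𝕜 (p.map f) = Module.finrank 𝕜 p :=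
  (Submodule.equivMapOfInjective f hf p).finrank_eq.symm

theorem natCard_eigenvalues_eq {𝕜 E : Type*} [RCLike 𝕜] [NormedAddCommGroup E]
    [InnerProductSpace 𝕜 E] [FiniteDimensional 𝕜 E] {n : ℕ} {T : E →ₗ[𝕜] E} (hT : T.IsSymmetric)
    (hn : Module.finrank 𝕜 E = n) (μ : 𝕜) :
    Nat.card {k // (hT.eigenvalues hn k : 𝕜) = μ} = Module.finrank 𝕜 (eigenspace T μ) := by
  classical
  rw [← hT.card_filter_eigenvalues_eq hn, Nat.card_eq_fintype_card, Fintype.card_subtype]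

variable {𝕜 H G : Type*} [RCLike 𝕜]
  [NormedAddCommGroup H] [InnerProductSpace 𝕜 H] [CompleteSpace H]
  [NormedAddCommGroup G] [InnerProductSpace 𝕜 G] [CompleteSpace G]
  {ι : H →L[𝕜] G} {H₁ H₂ : Submodule 𝕜 H} [CompleteSpace H₁] [CompleteSpace H₂]

/-- `M` inverts S₂ on X and carries eigenvectors of `T` to solutions of the problem on X, whose
right side is the inner product of S₂X. -/
theorem finrank_pencilEigenspace {lam : ℝ} {Z : H →L[𝕜] H}
    (hZ : ∀ φ ψ, formA ι H₂ lam φ ψ = ⟪ψ, Z φ⟫_𝕜)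
    {M : (eigX ι H₁ lam).map (H₂.starProjection : H →ₗ[𝕜] H) →ₗ[𝕜] H}
    {T : Module.End 𝕜 ((eigX ι H₁ lam).map (H₂.starProjection : H →ₗ[𝕜] H))}
    (hM : ∀ y, M y ∈ eigX ι H₁ lam ∧ H₂.starProjection (M y) = y)
    (hM' : ∀ φ (hφ : φ ∈ eigX ι H₁ lam), M ⟨H₂.starProjection φ, φ, hφ, rfl⟩ = φ)
    (hT : ∀ y y', ⟪y, T y'⟫_𝕜 = ⟪M y, Z (M y')⟫_𝕜) (t : 𝕜) :
    Module.finrank 𝕜 (pencilEigenspace ι H₁ H₂ lam t) = Module.finrank 𝕜 (eigenspace T t) := by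
  have hinj : Function.Injective M := fun y y' h => by
    rw [Subtype.ext_iff, ← (hM y).2, ← (hM y').2, h]
  have heq : pencilEigenspace ι H₁ H₂ lam t = (eigenspace T t).map M := by
    ext φ
    constructor
    · rintro ⟨hφ, h⟩
      refine ⟨⟨H₂.starProjection φ, φ, hφ, rfl⟩, mem_eigenspace_iff.2 ?_, hM' φ hφ⟩
      refine ext_inner_left 𝕜 fun y => ?_
      rw [hT, hM' φ hφ, ← hZ, h _ (hM y).1, (hM y).2, inner_smul_right]
      rfl
    · rintro ⟨y, hy, rfl⟩
      have hy' : T y = t • y := mem_eigenspace_iff.1 hy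
      refine ⟨(hM y).1, fun ψ hψ => ?_⟩
      have h := hT ⟨H₂.starProjection ψ, ψ, hψ, rfl⟩ y
      rw [hM' ψ hψ, hy', inner_smul_right] at h
      rw [hZ, ← h, (hM y).2]
      rfl
  rw [heq]
  exact finrank_map_eq_of_injective hinj _

variable {κ' d η : ℝ} {U : Set ℝ}

theorem map_eigenspace_restrict (κ : ℝ) {T : Module.End 𝕜 (windowSpace ι H₂ κ' η U)}
    (hT : ∀ w, (T w : H) = extGram ι H₂ w - (κ : 𝕜) • (w : H)) {r : ℝ}
    (hr : r ∈ window κ' η U) :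
    (eigenspace T ((r - κ : ℝ) : 𝕜)).map (windowSpace ι H₂ κ' η U).subtype =
      eigenspace (extGram ι H₂ : H →ₗ[𝕜] H) (r : 𝕜) := by
  ext u
  constructor
  · rintro ⟨w, hw, rfl⟩
    have hw' : T w = ((r - κ : ℝ) : 𝕜) • w := mem_eigenspace_iff.1 hw
    have h := hT w
    rw [hw', Submodule.coe_smul, RCLike.ofReal_sub, sub_smul, sub_left_inj] at h
    exact mem_eigenspace_iff.2 h.symm
  · intro hu
    have hu' : extGram ι H₂ u = (r : 𝕜) • u := mem_eigenspace_iff.1 hu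
    have hmem : u ∈ windowSpace ι H₂ κ' η U :=
      eigenspace_le_spectralSpan (extGram ι H₂) (Set.mem_image_of_mem _ hr) hu
    refine ⟨⟨u, hmem⟩, mem_eigenspace_iff.2 (Subtype.ext ?_), rfl⟩
    rw [hT, Submodule.coe_smul, hu', RCLike.ofReal_sub, sub_smul]

/-- The relative size of the component of `S₂ φ` outside the window is at most
`defectConst c₀ κ d * √σ`. -/
noncomputable def defectConst (c₀ κ d : ℝ) : ℝ := 2 / d * (2 * c₀) * (2 * c₀ ^ 2 / κ)

/-- The constant in the asymptotic formula. -/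
noncomputable def splittingConst (c₀ κ d : ℝ) : ℝ :=
  4 * formConst c₀ κ (κ / 2) (d / 2) * (2 * c₀ ^ 2 / κ) ^ 2 + 2 * defectConst c₀ κ d ^ 2

theorem formConst_pos {c₀ κ β δ : ℝ} (hc₀ : 0 ≤ c₀) (hκ : 0 < κ) (hβ : 0 < β) (hδ : 0 < δ) :
    0 < formConst c₀ κ β δ := by
  unfold formConst
  positivity

theorem exists_eigenvalues_of_isIsolated {lam c₀ : ℝ} (hlam : 0 < lam)
    (h : IsIsolated ι H₁ lam⁻¹ κ' d U) (hι : IsCompactOperator ι) (hc₀ : 0 < c₀)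
    (hιb : ∀ u, ‖ι u‖ ≤ c₀ * ‖u‖) (hη : η = 2 * c₀ * √(proximity ι H₁ H₂)) (hηd : 2 * η < d)
    (hs : defectConst c₀ lam⁻¹ d * √(proximity ι H₁ H₂) ≤ 1 / 2) :
    ∃ μ τ : Fin (Module.finrank 𝕜 (eigX ι H₁ lam)) → ℝ,
      (∀ k, 0 < μ k ∧ |(μ k)⁻¹ - lam⁻¹| ≤ η) ∧
      (∀ r ∈ window κ' η U, Nat.card {k // (μ k)⁻¹ = r} = eigenMult (gramOp ι H₂) r) ∧
      (∀ t : 𝕜, Nat.card {k // ((τ k : ℝ) : 𝕜) = t} =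
        Module.finrank 𝕜 (pencilEigenspace ι H₁ H₂ lam t)) ∧
      ∀ k, |(μ k)⁻¹ - (lam⁻¹ + τ k)| ≤ splittingConst c₀ lam⁻¹ d *
        (rho ι H₁ H₂ lam + |τ k| * proximity ι H₁ H₂) := by
  set σ := proximity ι H₁ H₂
  set ρ := rho ι H₁ H₂ lam
  have hσ : 0 ≤ σ := (isLeast_proximity ι H₁ H₂).1.1
  have hρ : 0 ≤ ρ := rho_nonneg ι H₁ H₂ lam
  have hκ : 0 < lam⁻¹ := inv_pos.2 hlam
  have hd := h.gap_pos
  have hdκ : d ≤ lam⁻¹ := by linarith [h.gap_le_lower, h.pos]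
  have hs0 : 0 ≤ √σ := Real.sqrt_nonneg σ
  have hη0 : 0 ≤ η := by rw [hη]; positivity
  have hpert : ∀ u, ‖extGram ι H₁ u - extGram ι H₂ u‖ ≤ η * ‖u‖ := fun u => by
    rw [hη]; exact norm_extGram_sub_le hc₀.le hιb H₁ H₂ u
  set X := eigX ι H₁ lam with hXdef
  have hX : X = eigenspace (extGram ι H₁ : H →ₗ[𝕜] H) ((lam⁻¹ : ℝ) : 𝕜) :=
    eigX_eq_eigenspace ι H₁ hlam.ne'
  have hXfin : FiniteDimensional 𝕜 X := by
    rw [hX]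
    exact ContinuousLinearMap.finite_dimensional_eigenspace
      (extGram_isCompactOperator hι H₁) _ (by exact_mod_cast hκ.ne')
  set W := windowSpace ι H₂ κ' η U
  have hWinv : ∀ u ∈ W, extGram ι H₂ u ∈ W := fun u hu => apply_mem_spectralSpan _ _ hu
  obtain ⟨hWfin, hWle⟩ := finiteDimensional_and_finrank_le_of_inf_orthogonal (W := W) (X := X)
    fun u hu hu' => h.eq_zero_of_mem_orthogonal hι hη0 hpert hηd hu (hX ▸ hu')
  set θ := 2 * c₀ ^ 2 / lam⁻¹ with hθ
  have hθ0 : 0 < θ := by positivity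
  set A := defectConst c₀ lam⁻¹ d with hA
  have hA0 : 0 < A := by rw [hA, defectConst]; positivity
  have hφx : ∀ φ ∈ X, ‖φ‖ ≤ θ * ‖H₂.starProjection φ‖ := fun φ hφ => by
    have := mul_norm_le_norm_starProjection hc₀.le hιb hκ.le hpert (by linarith) (hX ▸ hφ)
    rw [hθ, div_mul_eq_mul_div, le_div_iff₀ hκ]
    linarith
  have hqx : ∀ φ ∈ X, ‖H₂.starProjection φ - W.starProjection (H₂.starProjection φ)‖ ≤
      A * √σ * ‖H₂.starProjection φ‖ := fun φ hφ => by
    have h1 := h.norm_starProjection_sub_le hι hpert (by linarith) (hX ▸ hφ)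
    have h2 := mul_le_mul_of_nonneg_left (hφx φ hφ) hη0
    have h3 : A * √σ * ‖H₂.starProjection φ‖ =
        (η * (θ * ‖H₂.starProjection φ‖)) / (d / 2) := by
      rw [hA, defectConst, hη, hθ]; field_simp
    rw [h3, le_div_iff₀ (by positivity), mul_comm]
    exact h1.trans h2
  have hSinj : ∀ φ ∈ X, H₂.starProjection φ = 0 → φ = 0 := fun φ hφ h0 => by
    have := hφx φ hφ
    rw [h0, norm_zero, mul_zero] at this
    exact norm_le_zero_iff.1 this
  obtain ⟨Z, hZsymm, hZ⟩ := exists_isSymmetric_formA ι H₂ lam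
  obtain ⟨M, T, hTsymm, hM, hM', hT, hdimY⟩ := exists_transported_operator hSinj hZsymm
  -- The orthogonal projection from S₂X to W. By Pythagoras and `hqx` it is isometric up to ε = A²σ.
  let e : (X.map (H₂.starProjection : H →ₗ[𝕜] H)) →ₗ[𝕜] W := (W.orthogonalProjectionOnto : H →ₗ[𝕜] W) ∘ₗ
    (X.map (H₂.starProjection : H →ₗ[𝕜] H)).subtype
  have he : ∀ y : X.map (H₂.starProjection : H →ₗ[𝕜] H), (e y : H) = W.starProjection (H₂.starProjection (M y)) := fun y => by
    rw [(hM y).2]; rfl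
  have henorm : ∀ y : X.map (H₂.starProjection : H →ₗ[𝕜] H), ‖e y‖ ^ 2 ≤ ‖y‖ ^ 2 ∧ (1 - A ^ 2 * σ) * ‖y‖ ^ 2 ≤ ‖e y‖ ^ 2 := by
    intro y
    have h1 := hqx (M y) (hM y).1
    rw [(hM y).2] at h1
    have h2 := Submodule.norm_sq_eq_add_norm_sq_starProjection (y : H) W
    rw [Submodule.starProjection_orthogonal_val] at h2
    have h3 : ‖e y‖ = ‖W.starProjection (y : H)‖ := rfl
    have h4 : ‖y‖ = ‖(y : H)‖ := rfl
    rw [h3, h4]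
    have h5 := pow_le_pow_left₀ (norm_nonneg _) h1 2
    rw [mul_pow, mul_pow, Real.sq_sqrt hσ] at h5
    constructor <;> nlinarith [sq_nonneg ‖(y : H) - W.starProjection (y : H)‖]
  have hε : A ^ 2 * σ ≤ 1 / 2 := by
    have := pow_le_pow_left₀ (by positivity) hs 2
    rw [mul_pow, Real.sq_sqrt hσ] at this
    linarith
  have hdimW : Module.finrank 𝕜 W = Module.finrank 𝕜 X := by
    refine le_antisymm hWle (hdimY ▸ LinearMap.finrank_le_finrank_of_injective (f := e) ?_)
    rw [← LinearMap.ker_eq_bot, LinearMap.ker_eq_bot']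
    intro y hy
    have h1 := (henorm y).2
    rw [hy, norm_zero] at h1
    have h2 : ‖y‖ ^ 2 ≤ 0 := by nlinarith [sq_nonneg ‖y‖]
    exact norm_eq_zero.1 (pow_eq_zero_iff two_ne_zero |>.1 (le_antisymm h2 (sq_nonneg _)))
  let T' : Module.End 𝕜 W :=
    (extGram ι H₂ : H →ₗ[𝕜] H).restrict hWinv - ((lam⁻¹ : ℝ) : 𝕜) • LinearMap.id
  have hT' : ∀ w : W, (T' w : H) = extGram ι H₂ w - ((lam⁻¹ : ℝ) : 𝕜) • (w : H) := fun w => rfl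
  have hT'symm : T'.IsSymmetric := fun w w' => by
    rw [Submodule.coe_inner, Submodule.coe_inner, hT', hT', inner_sub_left, inner_sub_right,
      inner_smul_left, inner_smul_right, RCLike.conj_ofReal]
    congr 1
    exact extGram_isSymmetric ι H₂ w w'
  set K := formConst c₀ lam⁻¹ (lam⁻¹ / 2) (d / 2) with hK
  have hK0 : 0 < K := formConst_pos hc₀.le hκ (by positivity) (by positivity)
  have hform : ∀ y : X.map (H₂.starProjection : H →ₗ[𝕜] H), |RCLike.re ⟪y, T y⟫_𝕜 - RCLike.re ⟪e y, T' (e y)⟫_𝕜| ≤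
      2 * K * θ ^ 2 * ρ * ‖y‖ ^ 2 := by
    intro y
    have hφ := (hM y).1
    have h1 := abs_re_formA_sub_le (W := W) (windowSpace_le h.pos hη0) hWinv hlam hc₀.le hιb
      (β := lam⁻¹ / 2) (δ := d / 2) (by positivity) (by positivity)
      (fun u hu => by
        have h2 := h.norm_sub_smul_le hι hη0 hpert hu
        have h3 := norm_sub_norm_le (((lam⁻¹ : ℝ) : 𝕜) • u) (extGram ι H₂ u)
        rw [norm_sub_rev, norm_smul, RCLike.norm_of_nonneg hκ.le] at h3
        have : η * ‖u‖ ≤ lam⁻¹ / 2 * ‖u‖ := by gcongr; linarith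
        linarith)
      (fun u hu => h.le_norm_sub_smul hι (by linarith) hu)
      (norm_sq_apply_of_mem_eigenspace (H₁ := H₁) hκ.ne' (by rw [← hX]; exact hφ)) rfl
    rw [hT, ← hZ, Submodule.coe_inner, hT', he]
    refine h1.trans ?_
    have h2 := norm_sq_add_norm_sq_le_rho ι H₁ H₂ lam hφ
    have h3 := hφx (M y) hφ
    rw [(hM y).2] at h3
    have h4 := pow_le_pow_left₀ (norm_nonneg _) h3 2
    have h5 : (‖ι (opT H₂ (M y))‖ + ‖ι (psi ι H₂ lam (M y) : H)‖) ^ 2 ≤ 2 * (ρ * ‖M y‖ ^ 2) := by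
      nlinarith [sq_nonneg (‖ι (opT H₂ (M y))‖ - ‖ι (psi ι H₂ lam (M y) : H)‖)]
    have h6 : ρ * ‖M y‖ ^ 2 ≤ ρ * (θ * ‖y‖) ^ 2 := mul_le_mul_of_nonneg_left h4 hρ
    calc _ ≤ K * (2 * (ρ * (θ * ‖y‖) ^ 2)) := by gcongr; linarith
      _ = _ := by ring
  have hcomp := abs_eigenvalues_sub_le hTsymm hT'symm hdimY hdimW e hε
    (r := 2 * K * θ ^ 2 * ρ) (by positivity) henorm hform
  set t := hT'symm.eigenvalues hdimW with ht
  have htη : ∀ k, |t k| ≤ η := fun k => by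
    set w := hT'symm.eigenvectorBasis hdimW k
    have hw : T' w = (t k : 𝕜) • w := hT'symm.apply_eigenvectorBasis hdimW k
    have hw1 : ‖(w : H)‖ = 1 := (hT'symm.eigenvectorBasis hdimW).orthonormal.1 k
    have h1 := h.norm_sub_smul_le hι hη0 hpert w.2
    rwa [← hT', hw, Submodule.coe_smul, norm_smul, RCLike.norm_ofReal, hw1, mul_one, mul_one] at h1
  -- Both lists are in decreasing order, the numbering that min-max pairs.
  refine ⟨fun k => (lam⁻¹ + t k)⁻¹, hTsymm.eigenvalues hdimY, fun k => ⟨?_, ?_⟩, fun r hr => ?_,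
    fun z => ?_, fun k => ?_⟩
  · have := (abs_le.1 (htη k)).1
    exact inv_pos.2 (by linarith)
  · rw [inv_inv, add_sub_cancel_left]
    exact htη k
  · have hr0 : r ≠ 0 := by linarith [hr.1, h.pos]
    rw [eigenMult_gramOp ι H₂ hr0, ← map_eigenspace_restrict lam⁻¹ hT' hr,
      finrank_map_eq_of_injective W.subtype_injective,
      ← natCard_eigenvalues_eq hT'symm hdimW]
    refine Nat.card_congr (Equiv.subtypeEquivRight fun k => ?_)
    rw [inv_inv, RCLike.ofReal_inj, ← ht, eq_sub_iff_add_eq, add_comm]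
  · rw [finrank_pencilEigenspace hZ hM hM' hT, natCard_eigenvalues_eq hTsymm hdimY]
  · have h1 := hcomp k
    rw [inv_inv, ← sub_sub, add_sub_cancel_left]
    refine h1.trans ?_
    -- The bound `h1` is 4Kθ²ρ + 2A²σ|τ|; the mixed terms added here let one constant serve both
    -- summands.
    rw [splittingConst, ← hK, ← hA, ← hθ]
    have : 0 ≤ 2 * A ^ 2 * ρ := by positivity
    have : 0 ≤ 4 * K * θ ^ 2 * (|hTsymm.eigenvalues hdimY k| * σ) := by positivity
    linarith

end Splitting

/-! ### The gap of the given numbers and the choice of constants -/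

section Assembly

/-- The inverse of the `m - 1`-st number, if there is one. -/
def upperInverses {m : ℕ} (l : Fin (m + 2) → ℝ) : Set ℝ :=
  {x | ∃ j : Fin (m + 2), (j : ℕ) + 1 = m ∧ (l j)⁻¹ = x}

theorem upperInverses_subsingleton {m : ℕ} (l : Fin (m + 2) → ℝ) :
    (upperInverses l).Subsingleton := by
  rintro _ ⟨i, hi, rfl⟩ _ ⟨j, hj, rfl⟩
  have : i = j := Fin.ext (by omega)
  rw [this]

theorem exists_gap {m : ℕ} {l : Fin (m + 2) → ℝ} (hl : StrictMono l) (hpos : ∀ j, 0 < l j) :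
    ∃ d : ℝ, 0 < d ∧ d ≤ (l (Fin.last m).castSucc)⁻¹ - (l (Fin.last (m + 1)))⁻¹ ∧
      ∀ x ∈ upperInverses l, d ≤ x - (l (Fin.last m).castSucc)⁻¹ := by
  have h1 : 0 < (l (Fin.last m).castSucc)⁻¹ - (l (Fin.last (m + 1)))⁻¹ :=
    sub_pos.2 (inv_strictAnti₀ (hpos _) (hl (Fin.castSucc_lt_last _)))
  rcases (upperInverses_subsingleton l).eq_empty_or_singleton with hU | ⟨x, hU⟩
  · exact ⟨_, h1, le_rfl, by simp [hU]⟩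
  · obtain ⟨j, hj, hjx⟩ : x ∈ upperInverses l := by simp [hU]
    have h2 : 0 < x - (l (Fin.last m).castSucc)⁻¹ := by
      rw [← hjx]
      refine sub_pos.2 (inv_strictAnti₀ (hpos _) (hl ?_))
      rw [Fin.lt_def, Fin.val_castSucc, Fin.val_last]
      omega
    exact ⟨_, lt_min h1 h2, min_le_left _ _, by simp [hU]⟩

variable {𝕜 H G : Type*} [RCLike 𝕜]
  [NormedAddCommGroup H] [InnerProductSpace 𝕜 H] [CompleteSpace H]
  [NormedAddCommGroup G] [InnerProductSpace 𝕜 G] [CompleteSpace G]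

theorem IsFirstEigenvalues.isIsolated {ι : H →L[𝕜] G} {H₁ : Submodule 𝕜 H} [CompleteSpace H₁]
    {m : ℕ} {l : Fin (m + 2) → ℝ} (h : IsFirstEigenvalues (gramOp ι H₁) l) {d : ℝ} (hd : 0 < d)
    (hlow : d ≤ (l (Fin.last m).castSucc)⁻¹ - (l (Fin.last (m + 1)))⁻¹)
    (hup : ∀ x ∈ upperInverses l, d ≤ x - (l (Fin.last m).castSucc)⁻¹) :
    IsIsolated ι H₁ (l (Fin.last m).castSucc)⁻¹ (l (Fin.last (m + 1)))⁻¹ d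
      (upperInverses l) where
  gap_pos := hd
  pos := inv_pos.2 (h.2.1 _).1
  gap_le_lower := hlow
  gap_le_upper := hup
  subsingleton := upperInverses_subsingleton l
  spectrum r hr := by
    obtain ⟨hmono, hpos, hex⟩ := h
    obtain ⟨r', hr0, hrr'⟩ := exists_real_of_hasEigenvalue_extGram ι H₁ hr
    obtain rfl : r = r' := by exact_mod_cast hrr'
    rcases hr0.eq_or_lt with rfl | hr0
    · exact Or.inr (Or.inl (inv_nonneg.2 (hpos _).1.le))
    have hr' : Module.End.HasEigenvalue (gramOp ι H₁ : H₁ →ₗ[𝕜] H₁) ((r⁻¹⁻¹ : ℝ) : 𝕜) := by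
      rw [inv_inv]
      exact (hasEigenvalue_gramOp_iff ι H₁ (by exact_mod_cast hr0.ne')).2 hr
    rcases hex r⁻¹ (inv_pos.2 hr0) hr' with ⟨j, hj⟩ | hall
    · rw [← inv_inv r, ← hj]
      -- Index below m: at or above the upper neighbour; index m: κ itself; index m + 1: κ'.
      -- Eigenvalues past the list are below κ'.
      rcases lt_trichotomy (j : ℕ) m with hjm | hjm | hjm
      · refine Or.inr (Or.inr ⟨_, ⟨⟨m - 1, by omega⟩, by simp only; omega, rfl⟩, ?_⟩)
        refine inv_anti₀ (hpos _).1 (hmono.monotone ?_)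
        rw [Fin.le_def]
        simp only
        omega
      · have : j = (Fin.last m).castSucc := Fin.ext (by simpa using hjm)
        exact Or.inl (by rw [this])
      · have : j = Fin.last (m + 1) := Fin.ext (by rw [Fin.val_last]; omega)
        exact Or.inr (Or.inl (by rw [this]))
    · exact Or.inr (Or.inl ((le_inv_comm₀ hr0 (hpos _).1).2 (hall _).le))

end Assembly

end SpectralPerturbation

/-- `l 0 < ... < l (m + 1)` are `λ₁ < ... < λ_{m+2}`; the perturbed eigenvalue is the one with index
`m` counted from zero, the previous one (if any) has index `m - 1`, the next one index `m + 1`. The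
constants depend only on these numbers and on `c₀`. -/
theorem theorem1 (m : ℕ) (l : Fin (m + 2) → ℝ) (c₀ : ℝ) :
    ∃ σ₀ c C : ℝ, 0 < σ₀ ∧ 0 < c ∧ 0 < C ∧
      ∀ (𝕜 : Type*) [RCLike 𝕜]
        (H : Type*) [NormedAddCommGroup H] [InnerProductSpace 𝕜 H] [CompleteSpace H]
        (G : Type*) [NormedAddCommGroup G] [InnerProductSpace 𝕜 G] [CompleteSpace G]
        (ι : H →L[𝕜] G) (H₁ H₂ : Submodule 𝕜 H) [CompleteSpace H₁] [CompleteSpace H₂]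
        (lam lamNext σ : ℝ),
        Function.Injective ι → IsCompactOperator ι → (∀ u, ‖ι u‖ ≤ c₀ * ‖u‖) →
        ¬ FiniteDimensional 𝕜 H₁ → ¬ FiniteDimensional 𝕜 H₂ →
        SpectralPerturbation.IsFirstEigenvalues (SpectralPerturbation.gramOp ι H₁) l →
        lam = l (Fin.last m).castSucc → lamNext = l (Fin.last (m + 1)) →
        σ = SpectralPerturbation.proximity ι H₁ H₂ → σ ≤ σ₀ →
        -- the small interval about `lam⁻¹` lies inside the large one
        (lamNext⁻¹ + c * √σ < lam⁻¹ - c * √σ ∧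
          ∀ j : Fin (m + 2), (j : ℕ) + 1 = m → lam⁻¹ + c * √σ < (l j)⁻¹ - c * √σ) ∧
        ∃ μ τ : Fin (Module.finrank 𝕜 (SpectralPerturbation.eigX ι H₁ lam)) → ℝ,
          -- the `(μ k)⁻¹` lie in the small interval
          (∀ k, 0 < μ k ∧ |(μ k)⁻¹ - lam⁻¹| ≤ c * √σ) ∧
          -- the `(μ k)⁻¹` are, with multiplicities, all eigenvalues of `K₂` in the large interval
          (∀ κ : ℝ, lamNext⁻¹ + c * √σ < κ →
            (∀ j : Fin (m + 2), (j : ℕ) + 1 = m → κ < (l j)⁻¹ - c * √σ) →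
            Nat.card {k // (μ k)⁻¹ = κ} =
              SpectralPerturbation.eigenMult (SpectralPerturbation.gramOp ι H₂) κ) ∧
          -- the `τ k` are, with multiplicities, all eigenvalues of the problem on `X`
          (∀ t : 𝕜, Nat.card {k // ((τ k : ℝ) : 𝕜) = t} =
            Module.finrank 𝕜 (SpectralPerturbation.pencilEigenspace ι H₁ H₂ lam t)) ∧
          -- the asymptotic formula
          ∀ k, |(μ k)⁻¹ - (lam⁻¹ + τ k)| ≤
            C * (SpectralPerturbation.rho ι H₁ H₂ lam + |τ k| * σ) := by
  by_cases hl : StrictMono l ∧ (∀ j, 0 < l j) ∧ 0 < c₀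
  swap
  -- The constants precede the spaces, so impossible data `l`, `c₀` are disposed of vacuously; c₀ >
  -- 0 since `ι` does not vanish on an eigenvector of K₁.
  · refine ⟨1, 1, 1, one_pos, one_pos, one_pos, ?_⟩
    intro 𝕜 _ H _ _ _ G _ _ _ ι H₁ H₂ _ _ lam lamNext σ hinj _ hb _ _ hfirst
    refine absurd ⟨hfirst.1, fun j => (hfirst.2.1 j).1, ?_⟩ hl
    obtain ⟨u, -, hu⟩ := (hfirst.2.1 0).2.exists_hasEigenvector
    have hu0 : (u : H) ≠ 0 := fun h => hu (Subtype.ext h)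
    have h1 : 0 < ‖ι u‖ := norm_pos_iff.2 fun h => hu0 (hinj (by rw [h, map_zero]))
    exact pos_of_mul_pos_left (h1.trans_le (hb u)) (norm_nonneg _)
  obtain ⟨hmono, hpos, hc₀⟩ := hl
  obtain ⟨d, hd, hlow, hup⟩ := SpectralPerturbation.exists_gap hmono hpos
  have hκ : 0 < (l (Fin.last m).castSucc)⁻¹ := inv_pos.2 (hpos _)
  set A := SpectralPerturbation.defectConst c₀ (l (Fin.last m).castSucc)⁻¹ d with hA
  have hA0 : 0 < A := by rw [hA, SpectralPerturbation.defectConst]; positivity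
  -- The first entry gives η ≤ d/4, which separates the intervals and yields 2η < d; the second
  -- gives A√σ ≤ 1/2, hence ε ≤ 1/2 in the comparison.
  refine ⟨min (d / (8 * c₀)) (1 / (2 * A)) ^ 2, 2 * c₀,
    SpectralPerturbation.splittingConst c₀ (l (Fin.last m).castSucc)⁻¹ d, by positivity,
    by positivity, ?_, ?_⟩
  · have := SpectralPerturbation.formConst_pos hc₀.le hκ (half_pos hκ) (half_pos hd)
    rw [SpectralPerturbation.splittingConst]
    positivity
  intro 𝕜 _ H _ _ _ G _ _ _ ι H₁ H₂ _ _ lam lamNext σ hinj hcomp hb _ _ hfirst hlam hlamNext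
    hσ hσ₀
  have hs := Real.sqrt_le_sqrt hσ₀
  rw [Real.sqrt_sq (by positivity), le_min_iff, le_div_iff₀ (by positivity),
    le_div_iff₀ (by positivity)] at hs
  subst hlam hlamNext hσ
  have hiso := hfirst.isIsolated hd hlow hup
  obtain ⟨μ, τ, h1, h2, h3, h4⟩ := SpectralPerturbation.exists_eigenvalues_of_isIsolated
    (hpos _) hiso hcomp hc₀ hb rfl (by linarith [hs.1]) (by linarith [hs.2])
  refine ⟨⟨by linarith [hs.1], fun j hj => ?_⟩, μ, τ, h1, fun r hr hr' => h2 r ⟨hr, ?_⟩, h3, h4⟩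
  · linarith [hs.1, hup _ ⟨j, hj, rfl⟩]
  · rintro _ ⟨j, hj, rfl⟩
    exact hr' j hj
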